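/- Let $p_1,p_2,n,r$ be natural numbers. For random vectors $\beta^{(1)},\dots,\beta^{(n)}\in\mathbb R^{p_1}$ and $\gamma^{(1)},\dots,\gamma^{(n)}\in\mathbb R^{p_2}$, all of whose entries are jointly independent $N(0,1)$ random variables, let $\mathcal X:\mathbb R^{p_1\times p_2}\to\mathbb R^n$ be the random linear map $[\mathcal X(A)]_i=(\beta^{(i)})^{\top}A\,\gamma^{(i)}$, $i=1,\dots,n$. Let $\|M\|_*$ denote the nuclear norm of $M$, i.e. the sum of its singular values. There exist universal constants $C>0$ and $\delta>0$ (not depending on $p_1,p_2,n,r$) such that, whenever $n\ge C\,r\,(p_1+p_2)$, the following holds with probability at least $1-e^{-n\delta}$: simultaneously for all matrices $A\in\mathbb R^{p_1\times p_2}$ of rank at most $r$, the minimization problem $$\min_{M\in\mathbb R^{p_1\times p_2}}\ \{\|M\|_*:\ \mathcal X(M)=\mathcal X(A)\}$$ has $A$ as its unique solution. -/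

import Mathlib

open MeasureTheory ProbabilityTheory Matrix

/-- The nuclear norm of a real `p₁ × p₂` matrix: the sum of its singular values. Mathlib's
(zero-indexed, decreasing) sequence of singular values is padded by zeros, and the singular values
with index at least `min p₁ p₂` vanish, so that summing over the `p₂` first ones takes all of them
into account. -/
noncomputable def nuclearNorm {p₁ p₂ : ℕ} (A : Matrix (Fin p₁) (Fin p₂) ℝ) : ℝ :=
  ∑ i ∈ Finset.range p₂, (Matrix.toEuclideanLin A).singularValues i

/-- The linear map `A ↦ ((β⁽ⁱ⁾)ᵀ A γ⁽ⁱ⁾)ᵢ` given by the vectors `β⁽ⁱ⁾ ∈ ℝ^p₁`, `γ⁽ⁱ⁾ ∈ ℝ^p₂`,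
`i = 1, …, n`. -/
def ropMap {n p₁ p₂ : ℕ} (β : Fin n → Fin p₁ → ℝ) (γ : Fin n → Fin p₂ → ℝ) :
    Matrix (Fin p₁) (Fin p₂) ℝ →ₗ[ℝ] (Fin n → ℝ) where
  toFun A i := β i ⬝ᵥ (A *ᵥ γ i)
  map_add' A B := by
    funext i
    simp [Matrix.add_mulVec, dotProduct_add]
  map_smul' c A := by
    funext i
    simp [Matrix.smul_mulVec, dotProduct_smul]

/-- The random linear map `𝒳` is ROP (rank-one projection) from the distribution `ν`: it is
`A ↦ ((β⁽ⁱ⁾)ᵀ A γ⁽ⁱ⁾)ᵢ` for random vectors `β⁽ⁱ⁾`, `γ⁽ⁱ⁾` all of whose entries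
`β⁽ⁱ⁾ⱼ`, `γ⁽ⁱ⁾ₖ` together form a family of independent random variables with law `ν`. -/
def IsROP {Ω : Type*} [MeasurableSpace Ω] {n p₁ p₂ : ℕ}
    (𝒳 : Ω → Matrix (Fin p₁) (Fin p₂) ℝ →ₗ[ℝ] (Fin n → ℝ)) (ν : Measure ℝ) (P : Measure Ω) :
    Prop :=
  ∃ (β : Fin n → Fin p₁ → Ω → ℝ) (γ : Fin n → Fin p₂ → Ω → ℝ),
    (∀ i j, HasLaw (β i j) ν P) ∧
    (∀ i k, HasLaw (γ i k) ν P) ∧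
    iIndepFun
      (Sum.elim (fun q : Fin n × Fin p₁ => β q.1 q.2) (fun q : Fin n × Fin p₂ => γ q.1 q.2)) P ∧
    ∀ ω, 𝒳 ω = ropMap (fun i j => β i j ω) (fun i k => γ i k ω)

/-- `M` is a solution of noiseless nuclear norm minimization,
`M ∈ argmin {‖M'‖_* : 𝒳(M') = y}`. -/
def IsNuclearNormMinimizer {n p₁ p₂ : ℕ}
    (𝒳 : Matrix (Fin p₁) (Fin p₂) ℝ →ₗ[ℝ] (Fin n → ℝ)) (y : Fin n → ℝ)
    (M : Matrix (Fin p₁) (Fin p₂) ℝ) : Prop :=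
  𝒳 M = y ∧ ∀ M' : Matrix (Fin p₁) (Fin p₂) ℝ, 𝒳 M' = y → nuclearNorm M ≤ nuclearNorm M'

/-- Noiseless nuclear norm minimization recovers exactly all matrices of rank at most `r`: for
every such `A`, the minimization problem with data `y = 𝒳(A)` has `A` as its one and only
solution. -/
def RecoversRank {n p₁ p₂ : ℕ}
    (𝒳 : Matrix (Fin p₁) (Fin p₂) ℝ →ₗ[ℝ] (Fin n → ℝ)) (r : ℕ) : Prop :=
  ∀ A : Matrix (Fin p₁) (Fin p₂) ℝ, A.rank ≤ r →
    ∀ M : Matrix (Fin p₁) (Fin p₂) ℝ, IsNuclearNormMinimizer 𝒳 (𝒳 A) M ↔ M = A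

/-! If some `M ≠ A` competes with `A`, then `H = M - A` is a nonzero kernel element and adding it to
`A` does not increase the nuclear norm. Such an `H` has `‖H‖_* ≤ 3√r ‖H‖_F`
(`nuclearNorm_le_of_descent`), so it suffices that the kernel meets this cone only at 0
(`recoversRank_of_cone`), a condition free of `A`.

Measurements are sized in ℓ¹, by `f(D) = ∑ |βᵀDγ|`: a product of Gaussians has exponential moments,
its square has none, so ℓ² sums lack the required upper tail. For a fixed `D`, `f(D)` lies between
`n‖D‖/448` and `6n‖D‖` except with probability `2 exp(-n/50176)` (`measure_distorted_le`).

Uniformity is needed only over products `A * Bᵀ` of inner width `m`, a large multiple of `r`, with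
`A` in the Frobenius unit ball and `B` a contraction. Nets for these have log-size `O(m(p₁+p₂))`,
which `n ≥ C r (p₁+p₂)` pays for; `Seminorm.factor_upper` and `Seminorm.factor_lower` pass from nets
to all factors. Cutting the singular value decomposition of `H` into blocks of width `m` writes `H`
as a sum of such products up to scaling. The blocks after the first have total Frobenius norm at
most `‖H‖_*/√m`, a tiny fraction of `‖H‖_F`, so `f(H) = 0` would contradict the lower bound on the
first block (`Seminorm.eq_zero_of_factor_bounds`). -/

open scoped Matrix.Norms.Frobenius

/-- A real matrix of Euclidean operator norm at most one. -/
def Matrix.IsContraction {l k : Type*} [Fintype l] [Fintype k] (W : Matrix l k ℝ) : Prop :=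
  ∀ x : k → ℝ, (W *ᵥ x) ⬝ᵥ (W *ᵥ x) ≤ x ⬝ᵥ x

/-! ### Frobenius norm and contractions. -/

section Frobenius

variable {l k q : Type*} [Fintype l] [Fintype k] [Fintype q]

theorem frobenius_sq (A : Matrix l k ℝ) : ‖A‖ ^ 2 = ∑ i, ∑ j, A i j ^ 2 := by
  have h : 0 ≤ ∑ i, ∑ j, A i j ^ 2 := by positivity
  rw [Matrix.frobenius_norm_def, ← Real.sqrt_eq_rpow]
  simp only [Real.norm_eq_abs, Real.rpow_two, sq_abs]
  exact Real.sq_sqrt h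

theorem frobenius_sq_rows (A : Matrix l k ℝ) : ‖A‖ ^ 2 = ∑ i, A i ⬝ᵥ A i := by
  rw [frobenius_sq]
  simp [dotProduct, sq]

theorem frobenius_sq_trace (A : Matrix l k ℝ) : ‖A‖ ^ 2 = (Aᵀ * A).trace := by
  rw [frobenius_sq, Finset.sum_comm]
  simp [trace, Matrix.mul_apply, sq]

theorem abs_trace_transpose_mul_le (W M : Matrix l k ℝ) : |(Wᵀ * M).trace| ≤ ‖W‖ * ‖M‖ := by
  apply abs_le_of_sq_le_sq _ (by positivity)
  rw [mul_pow, frobenius_sq, frobenius_sq]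
  have e : (Wᵀ * M).trace = ∑ x : l × k, W x.1 x.2 * M x.1 x.2 := by
    simp [trace, Matrix.mul_apply, Fintype.sum_prod_type]
    exact Finset.sum_comm
  rw [e, ← Fintype.sum_prod_type', ← Fintype.sum_prod_type']
  exact Finset.sum_mul_sq_le_sq_mul_sq _ _ _

theorem real_dotProduct_self_nonneg (x : k → ℝ) : 0 ≤ x ⬝ᵥ x :=
  Finset.sum_nonneg fun _ _ => mul_self_nonneg _

theorem dotProduct_le_of_sq {x y : k → ℝ} : (x ⬝ᵥ y) ^ 2 ≤ (x ⬝ᵥ x) * (y ⬝ᵥ y) := by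
  have := Finset.sum_mul_sq_le_sq_mul_sq Finset.univ x y
  simpa [dotProduct, sq] using this

theorem mulVec_dotProduct_mulVec (A B : Matrix l k ℝ) (x y : k → ℝ) :
    (A *ᵥ x) ⬝ᵥ (B *ᵥ y) = x ⬝ᵥ ((Aᵀ * B) *ᵥ y) := by
  rw [← Matrix.mulVec_mulVec, Matrix.dotProduct_mulVec x, Matrix.vecMul_transpose]

namespace Matrix.IsContraction

theorem transpose {W : Matrix l k ℝ} (h : W.IsContraction) : Wᵀ.IsContraction := by
  intro y
  set u := Wᵀ *ᵥ y
  have h1 : u ⬝ᵥ u = y ⬝ᵥ (W *ᵥ u) := by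
    simp only [u]
    rw [mulVec_dotProduct_mulVec, transpose_transpose, Matrix.mulVec_mulVec]
  have h2 : (u ⬝ᵥ u) ^ 2 ≤ (y ⬝ᵥ y) * (u ⬝ᵥ u) := by
    conv_lhs => rw [h1]
    refine dotProduct_le_of_sq.trans ?_
    exact mul_le_mul_of_nonneg_left (h u) (real_dotProduct_self_nonneg y)
  by_contra! hlt
  have := (real_dotProduct_self_nonneg y)
  nlinarith

theorem mul {W : Matrix l k ℝ} {Z : Matrix k q ℝ} (h : W.IsContraction) (h' : Z.IsContraction) :
    (W * Z).IsContraction := by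
  intro x
  rw [← Matrix.mulVec_mulVec]
  exact (h _).trans (h' _)

theorem of_gram_eq_diagonal [DecidableEq k] {W : Matrix l k ℝ} {d : k → ℝ}
    (h : Wᵀ * W = diagonal d) (hd : ∀ i, d i ≤ 1) : W.IsContraction := by
  intro x
  rw [mulVec_dotProduct_mulVec, h]
  simp only [dotProduct, mulVec_diagonal]
  refine Finset.sum_le_sum fun i _ => ?_
  nlinarith [hd i, mul_self_nonneg (x i)]

/-- The single equation `Qᵀ * Q = Q` encodes both symmetry and idempotence, so `Q` is an orthogonal
projection. -/
theorem of_projection {Q : Matrix k k ℝ} (h : Qᵀ * Q = Q) : Q.IsContraction := by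
  intro x
  have hs : Qᵀ = Q := by
    conv_lhs => rw [← h]
    rw [Matrix.transpose_mul, Matrix.transpose_transpose, h]
  have h1 : (Q *ᵥ x) ⬝ᵥ (Q *ᵥ x) = x ⬝ᵥ (Q *ᵥ x) := by rw [mulVec_dotProduct_mulVec, h]
  have h2 : (Q *ᵥ x) ⬝ᵥ x = x ⬝ᵥ (Q *ᵥ x) := dotProduct_comm _ _
  have h3 := real_dotProduct_self_nonneg (x - Q *ᵥ x)
  simp only [sub_dotProduct, dotProduct_sub] at h3
  linarith

theorem of_partialIsometry {W : Matrix l k ℝ} (h : W * Wᵀ * W = W) : W.IsContraction := by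
  intro x
  have hQ : (Wᵀ * W)ᵀ * (Wᵀ * W) = Wᵀ * W := by
    rw [transpose_mul, transpose_transpose, Matrix.mul_assoc, ← Matrix.mul_assoc W, h]
  have := of_projection hQ x
  rw [mulVec_dotProduct_mulVec, hQ] at this
  rwa [mulVec_dotProduct_mulVec]

theorem one_sub_projection [DecidableEq k] {Q : Matrix k k ℝ} (h : Qᵀ * Q = Q) :
    (1 - Q)ᵀ * (1 - Q) = 1 - Q := by
  have hs : Qᵀ = Q := by
    conv_lhs => rw [← h]
    rw [Matrix.transpose_mul, Matrix.transpose_transpose, h]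
  rw [transpose_sub, transpose_one, hs, Matrix.sub_mul, Matrix.one_mul, Matrix.mul_sub,
    Matrix.mul_one]
  rw [hs] at h
  rw [h, sub_self, sub_zero]

/-- `W` sees only the range of `Q`, `Z` only its complement, and their images are orthogonal:
Pythagoras on both sides. -/
theorem add_of_orthogonal [DecidableEq k] {W Z : Matrix l k ℝ} {Q : Matrix k k ℝ}
    (hW : W.IsContraction) (hZ : Z.IsContraction) (hQ : Qᵀ * Q = Q) (hWZ : Wᵀ * Z = 0)
    (hWQ : W * Q = W) (hZQ : Z * Q = 0) : (W + Z).IsContraction := by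
  intro x
  have hZW : Zᵀ * W = 0 := by
    rw [← transpose_transpose (Zᵀ * W), transpose_mul, transpose_transpose, hWZ, transpose_zero]
  have e1 : W *ᵥ x = W *ᵥ (Q *ᵥ x) := by rw [Matrix.mulVec_mulVec, hWQ]
  have e2 : Z *ᵥ x = Z *ᵥ ((1 - Q) *ᵥ x) := by
    rw [Matrix.mulVec_mulVec, Matrix.mul_sub, hZQ, Matrix.mul_one, sub_zero]
  have h1 := hW (Q *ᵥ x)
  have h2 := hZ ((1 - Q) *ᵥ x)
  rw [← e1, mulVec_dotProduct_mulVec Q, hQ] at h1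
  rw [← e2, mulVec_dotProduct_mulVec (1 - Q), one_sub_projection hQ, Matrix.sub_mulVec,
    Matrix.one_mulVec, dotProduct_sub] at h2
  rw [Matrix.add_mulVec, add_dotProduct, dotProduct_add, dotProduct_add,
    mulVec_dotProduct_mulVec W Z, mulVec_dotProduct_mulVec Z W, hWZ, hZW]
  simp only [Matrix.zero_mulVec, dotProduct_zero]
  linarith

theorem norm_mul_transpose_le (A : Matrix q k ℝ) {B : Matrix l k ℝ} (h : B.IsContraction) :
    ‖A * Bᵀ‖ ≤ ‖A‖ := by
  refine le_of_sq_le_sq ?_ (norm_nonneg _)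
  rw [frobenius_sq_rows, frobenius_sq_rows]
  refine Finset.sum_le_sum fun i _ => ?_
  have : (A * Bᵀ) i = B *ᵥ (A i) := by
    ext j
    simp [Matrix.mul_apply, mulVec, dotProduct, mul_comm]
  rw [this]
  exact h _

theorem norm_mul_le (A : Matrix q l ℝ) {B : Matrix l k ℝ} (h : B.IsContraction) :
    ‖A * B‖ ≤ ‖A‖ := by
  simpa using norm_mul_transpose_le A h.transpose

theorem norm_mul_le' {A : Matrix q l ℝ} (B : Matrix l k ℝ) (h : A.IsContraction) :
    ‖A * B‖ ≤ ‖B‖ := by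
  rw [← frobenius_norm_transpose, transpose_mul, ← frobenius_norm_transpose B]
  exact norm_mul_transpose_le _ h

end Matrix.IsContraction

end Frobenius

/-! ### Singular vectors, duality and polar decomposition. -/

section NuclearNorm

variable {p₁ p₂ : ℕ}

/-- The singular values of a real matrix. -/
noncomputable abbrev Matrix.sv (A : Matrix (Fin p₁) (Fin p₂) ℝ) (i : ℕ) : ℝ :=
  (Matrix.toEuclideanLin A).singularValues i

/-- Right singular vectors suffice: the columns of `A * V` are then orthogonal with lengths `A.sv
i`, and no left basis has to be completed. -/
theorem exists_rightSingularVectors (A : Matrix (Fin p₁) (Fin p₂) ℝ) :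
    ∃ V : Matrix (Fin p₂) (Fin p₂) ℝ, Vᵀ * V = 1 ∧ V * Vᵀ = 1 ∧
      Vᵀ * (Aᵀ * A) * V = diagonal fun i : Fin p₂ => A.sv i ^ 2 := by
  set T := Matrix.toEuclideanLin A
  have hn : Module.finrank ℝ (EuclideanSpace ℝ (Fin p₂)) = p₂ := by simp
  set b := T.isSymmetric_adjoint_comp_self.eigenvectorBasis hn
  let V : Matrix (Fin p₂) (Fin p₂) ℝ := Matrix.of fun k l => b l k
  have hV : Vᵀ * V = 1 := by
    ext i j
    have := orthonormal_iff_ite.mp b.orthonormal i j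
    rw [Matrix.one_apply, ← this]
    simp only [Matrix.mul_apply, V, PiLp.inner_apply, transpose_apply, of_apply]
    exact Finset.sum_congr rfl fun k _ => mul_comm _ _
  refine ⟨V, hV, _root_.mul_eq_one_comm.mp hV, ?_⟩
  have key : Aᵀ * A * V = V * diagonal fun i : Fin p₂ => A.sv i ^ 2 := by
    ext k l
    have h : (LinearMap.adjoint T ∘ₗ T) (b l) = ((T.singularValues l ^ 2 : ℝ) : ℝ) • b l := by
      rw [LinearMap.sq_singularValues_fin T hn]
      exact T.isSymmetric_adjoint_comp_self.apply_eigenvectorBasis hn l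
    clear_value b
    have h2 := congrArg (fun v : EuclideanSpace ℝ (Fin p₂) => v k) h
    have hadj : LinearMap.adjoint T = Matrix.toEuclideanLin Aᵀ := by
      rw [← Matrix.toEuclideanLin_conjTranspose_eq_adjoint]
      simp
    rw [Matrix.mul_diagonal, mul_comm]
    simp only [LinearMap.comp_apply, hadj, T, Matrix.toLpLin_apply] at h2
    rw [Matrix.mul_assoc]
    have hL : (Aᵀ * (A * V)) k l = (Aᵀ *ᵥ (A *ᵥ (b l).ofLp)) k := by
      simp only [Matrix.mul_apply, mulVec, dotProduct, V, of_apply]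
    have hR : V k l = (b l).ofLp k := rfl
    rw [hL, hR]
    exact h2
  rw [Matrix.mul_assoc, key, ← Matrix.mul_assoc, hV, Matrix.one_mul]

theorem sv_nonneg (A : Matrix (Fin p₁) (Fin p₂) ℝ) (i : ℕ) : 0 ≤ A.sv i :=
  LinearMap.singularValues_nonneg _ _

theorem nuclearNorm_eq (A : Matrix (Fin p₁) (Fin p₂) ℝ) :
    nuclearNorm A = ∑ i : Fin p₂, A.sv i :=
  Finset.sum_range _

/-- Duality between the operator norm and the nuclear norm. -/
theorem Matrix.IsContraction.trace_le_nuclearNorm {W : Matrix (Fin p₁) (Fin p₂) ℝ}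
    (hW : W.IsContraction) (M : Matrix (Fin p₁) (Fin p₂) ℝ) :
    (Wᵀ * M).trace ≤ nuclearNorm M := by
  obtain ⟨V, hV, hV', hd⟩ := exists_rightSingularVectors M
  have h1 : (Wᵀ * M).trace = ((W * V)ᵀ * (M * V)).trace := by
    rw [transpose_mul, Matrix.mul_assoc, Matrix.trace_mul_comm Vᵀ, ← Matrix.mul_assoc,
      Matrix.mul_assoc, hV', Matrix.mul_one]
  rw [h1, nuclearNorm_eq, trace]
  refine Finset.sum_le_sum fun i _ => ?_
  have e : ∀ X Y : Matrix (Fin p₁) (Fin p₂) ℝ,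
      ((X * V)ᵀ * (Y * V)) i i = (X *ᵥ V.col i) ⬝ᵥ (Y *ᵥ V.col i) := by
    intro X Y
    rfl
  have hM : ((M * V)ᵀ * (M * V)) i i = M.sv i ^ 2 := by
    rw [transpose_mul, Matrix.mul_assoc, ← Matrix.mul_assoc Mᵀ, ← Matrix.mul_assoc, hd]
    simp
  have hv : V.col i ⬝ᵥ V.col i = 1 := by
    have := congrFun (congrFun hV i) i
    simpa [Matrix.mul_apply, dotProduct, Matrix.col] using this
  rw [diag_apply, e]
  rw [e] at hM
  refine le_of_sq_le_sq (a := _) ?_ (sv_nonneg M i)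
  refine dotProduct_le_of_sq.trans ?_
  rw [hM]
  have := hW (V.col i)
  rw [hv] at this
  nlinarith [sq_nonneg (M.sv i)]

/-- The partial isometry of the polar decomposition. -/
theorem exists_polar (A : Matrix (Fin p₁) (Fin p₂) ℝ) :
    ∃ W : Matrix (Fin p₁) (Fin p₂) ℝ, W * Wᵀ * W = W ∧ W * Wᵀ * A = A ∧
      (Wᵀ * A).trace = nuclearNorm A ∧ ‖W‖ ^ 2 = A.rank := by
  obtain ⟨V, hV, hV', hd⟩ := exists_rightSingularVectors A
  set s : Fin p₂ → ℝ := fun i => A.sv i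
  set χ : Fin p₂ → ℝ := fun i => if s i = 0 then 0 else 1
  -- The convention `0⁻¹ = 0` makes `W` vanish on the kernel of `A`, hence a partial isometry with
  -- exactly `A.rank` unit singular values.
  set W := A * V * diagonal (fun i => (s i)⁻¹) * Vᵀ with hWdef
  have hd' : Vᵀ * (Aᵀ * (A * V)) = diagonal fun i => s i ^ 2 := by
    rw [← hd]; simp only [Matrix.mul_assoc]
  have hAV : A * V * diagonal χ = A * V := by
    have : (A * V * (1 - diagonal χ)) = 0 := by
      have h0 : ‖A * V * (1 - diagonal χ)‖ ^ 2 = 0 := by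
        rw [frobenius_sq_trace, transpose_mul, transpose_mul]
        have : (1 - diagonal χ)ᵀ * (Vᵀ * Aᵀ) * (A * V * (1 - diagonal χ))
            = (1 - diagonal χ)ᵀ * (Vᵀ * (Aᵀ * (A * V))) * (1 - diagonal χ) := by
          simp only [Matrix.mul_assoc]
        rw [this, hd', ← diagonal_one, diagonal_sub, diagonal_transpose, diagonal_mul_diagonal,
          diagonal_mul_diagonal]
        simp only [trace_diagonal]
        refine Finset.sum_eq_zero fun i _ => ?_
        by_cases h : s i = 0 <;> simp [χ, h]
      exact norm_eq_zero.mp (pow_eq_zero_iff (two_ne_zero) |>.mp h0)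
    rw [Matrix.mul_sub, Matrix.mul_one, sub_eq_zero] at this
    exact this.symm
  have hVc : ∀ X : Matrix (Fin p₂) (Fin p₂) ℝ, Vᵀ * (V * X) = X := fun X => by
    rw [← Matrix.mul_assoc, hV, Matrix.one_mul]
  have hdc : ∀ X : Matrix (Fin p₂) (Fin p₂) ℝ, Vᵀ * (Aᵀ * (A * (V * X)))
      = (diagonal fun i => s i ^ 2) * X := fun X => by
    rw [← hd']; simp only [Matrix.mul_assoc]
  have hWt : Wᵀ = V * diagonal (fun i => (s i)⁻¹) * Vᵀ * Aᵀ := by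
    simp [W, transpose_mul, Matrix.mul_assoc]
  have hdd : ∀ (a b : Fin p₂ → ℝ) (X : Matrix (Fin p₂) (Fin p₂) ℝ),
      diagonal a * (diagonal b * X) = diagonal (fun i => a i * b i) * X := fun a b X => by
    rw [← Matrix.mul_assoc, diagonal_mul_diagonal]
  have hWW : Wᵀ * W = V * diagonal χ * Vᵀ := by
    rw [hWt]
    simp only [W, Matrix.mul_assoc]
    rw [hdc, hdd, hdd]
    congr 3
    ext i
    by_cases h : s i = 0
    · simp [χ, h]
    · simp only [χ, h, if_false]; field_simp
  have hWA : Wᵀ * (A * V) = V * diagonal s := by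
    rw [hWt]
    simp only [Matrix.mul_assoc]
    rw [hd', diagonal_mul_diagonal]
    congr 2
    ext i
    by_cases h : s i = 0
    · simp [h]
    · field_simp
  have hAVV : A * V * Vᵀ = A := by rw [Matrix.mul_assoc, hV', Matrix.mul_one]
  refine ⟨W, ?_, ?_, ?_, ?_⟩
  · rw [Matrix.mul_assoc, hWW]
    simp only [W, Matrix.mul_assoc]
    rw [hVc, hdd]
    congr 4
    ext i
    by_cases h : s i = 0 <;> simp [χ, h]
  · have : W * Wᵀ * A = W * (Wᵀ * (A * V)) * Vᵀ := by
      conv_lhs => rw [← hAVV]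
      simp only [Matrix.mul_assoc]
    rw [this, hWA]
    conv_rhs => rw [← hAVV, ← hAV]
    simp only [W, Matrix.mul_assoc]
    rw [hVc, hdd]
    congr 4
    ext i
    by_cases h : s i = 0 <;> simp [χ, h]
  · have : (Wᵀ * A) = Wᵀ * (A * V) * Vᵀ := by
      rw [Matrix.mul_assoc, hAVV]
    rw [this, hWA, Matrix.trace_mul_comm, ← Matrix.mul_assoc, hV, Matrix.one_mul, trace_diagonal,
      nuclearNorm_eq]
  · rw [frobenius_sq_trace, hWW, Matrix.trace_mul_comm, ← Matrix.mul_assoc, hV, Matrix.one_mul,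
      trace_diagonal]
    have hr : A.rank = (diagonal fun i => s i ^ 2).rank := by
      have hVu : IsUnit V.det := by
        rw [← Matrix.isUnit_iff_isUnit_det]
        exact IsUnit.of_mul_eq_one _ hV'
      have hVu' : IsUnit Vᵀ.det := by rwa [det_transpose]
      rw [← hd, rank_mul_eq_left_of_isUnit_det _ _ hVu, rank_mul_eq_right_of_isUnit_det _ _ hVu',
        rank_transpose_mul_self]
    rw [hr, rank_diagonal, Fintype.card_subtype, Finset.card_filter]
    push_cast
    refine Finset.sum_congr rfl fun i _ => ?_
    by_cases h : s i = 0 <;> simp [χ, h]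

end NuclearNorm

/-! ### The descent cone of the nuclear norm. -/

section Cone

variable {p₁ p₂ : ℕ}

theorem nuclearNorm_add_le (M N : Matrix (Fin p₁) (Fin p₂) ℝ) :
    nuclearNorm (M + N) ≤ nuclearNorm M + nuclearNorm N := by
  obtain ⟨W, hW, -, ht, -⟩ := exists_polar (M + N)
  have hc := IsContraction.of_partialIsometry hW
  rw [← ht, Matrix.mul_add, trace_add]
  exact add_le_add (hc.trace_le_nuclearNorm _) (hc.trace_le_nuclearNorm _)

/-- Pair the polar factor `W` of `P * M` with it and move `P` across: `‖Pᵀ * W‖ ≤ ‖P‖`. For a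
projection of rank at most `r`, `‖P‖ ≤ √r`, which is how the rank enters the cone. -/
theorem nuclearNorm_mul_le_left (P : Matrix (Fin p₁) (Fin p₁) ℝ)
    (M : Matrix (Fin p₁) (Fin p₂) ℝ) : nuclearNorm (P * M) ≤ ‖P‖ * ‖M‖ := by
  obtain ⟨W, hW, -, ht, -⟩ := exists_polar (P * M)
  have hc := IsContraction.of_partialIsometry hW
  rw [← ht, ← Matrix.mul_assoc, ← transpose_transpose P, ← transpose_mul, transpose_transpose]
  refine (le_abs_self _).trans ((abs_trace_transpose_mul_le _ _).trans ?_)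
  rw [← frobenius_norm_transpose P]
  exact mul_le_mul_of_nonneg_right (hc.norm_mul_le _) (norm_nonneg _)

theorem nuclearNorm_mul_le_right (M : Matrix (Fin p₁) (Fin p₂) ℝ)
    (Q : Matrix (Fin p₂) (Fin p₂) ℝ) : nuclearNorm (M * Q) ≤ ‖M‖ * ‖Q‖ := by
  obtain ⟨W, hW, -, ht, -⟩ := exists_polar (M * Q)
  have hc := IsContraction.of_partialIsometry hW
  rw [← ht, ← Matrix.mul_assoc, Matrix.trace_mul_comm, ← Matrix.mul_assoc,
    ← transpose_transpose Q, ← transpose_mul, transpose_transpose, mul_comm]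
  refine (le_abs_self _).trans ((abs_trace_transpose_mul_le _ _).trans ?_)
  rw [← frobenius_norm_transpose Q]
  exact mul_le_mul_of_nonneg_right (hc.norm_mul_le' _) (norm_nonneg _)

theorem norm_one_sub_projection_mul_le {l k : ℕ} {P : Matrix (Fin l) (Fin l) ℝ}
    (hP : Pᵀ * P = P) (M : Matrix (Fin l) (Fin k) ℝ) : ‖(1 - P) * M‖ ≤ ‖M‖ :=
  (IsContraction.of_projection (IsContraction.one_sub_projection hP)).norm_mul_le' M

/-- The descent cone of the nuclear norm at a matrix of rank at most `r` consists of matrices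
of effective rank `O(r)`. -/
theorem nuclearNorm_le_of_descent {A H : Matrix (Fin p₁) (Fin p₂) ℝ} {r : ℕ} (hr : A.rank ≤ r)
    (h : nuclearNorm (A + H) ≤ nuclearNorm A) : nuclearNorm H ≤ 3 * √r * ‖H‖ := by
  obtain ⟨W, hW, hWA, ht, hn⟩ := exists_polar A
  have hWc := IsContraction.of_partialIsometry hW
  have hWt : Wᵀ * (W * Wᵀ) = Wᵀ := by
    have := congrArg transpose hW
    simpa only [transpose_mul, transpose_transpose, Matrix.mul_assoc] using this
  set P := W * Wᵀ with hPdef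
  set Q := Wᵀ * W with hQdef
  have hPs : Pᵀ = P := by simp [P]
  have hQs : Qᵀ = Q := by simp [Q]
  have hPP : Pᵀ * P = P := by
    rw [hPs]; conv_lhs => rw [hPdef, ← Matrix.mul_assoc, hW]
  have hQQ : Qᵀ * Q = Q := by
    rw [hQs]; conv_lhs => rw [hQdef, ← Matrix.mul_assoc, Matrix.mul_assoc Wᵀ, ← hPdef, hWt]
  have hWQ : W * Q = W := by rw [hQdef, ← Matrix.mul_assoc, hW]
  have hWn : ‖W‖ ≤ √r := by
    apply Real.le_sqrt_of_sq_le
    rw [hn]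
    exact_mod_cast hr
  have hPn : ‖P‖ ≤ √r := (hWc.norm_mul_transpose_le W).trans hWn
  have hQn : ‖Q‖ ≤ √r := (hWc.transpose.norm_mul_le' W).trans hWn
  set H' := (1 - P) * H * (1 - Q) with hH'
  obtain ⟨Z, hZ, -, hZt, -⟩ := exists_polar H'
  have hZc := IsContraction.of_partialIsometry hZ
  -- Compressing `Z` makes it orthogonal to `W` on both sides, and pairing `Z'` with `H` is the same
  -- as pairing `Z` with `H'`.
  set Z' := (1 - P) * Z * (1 - Q) with hZ'
  have hZ'c : Z'.IsContraction :=
    ((IsContraction.of_projection (IsContraction.one_sub_projection hPP)).mul hZc).mul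
      (IsContraction.of_projection (IsContraction.one_sub_projection hQQ))
  have hWZ : Wᵀ * Z' = 0 := by
    have h0 : Wᵀ * (1 - P) = 0 := by rw [Matrix.mul_sub, hWt, Matrix.mul_one, sub_self]
    rw [hZ', ← Matrix.mul_assoc, ← Matrix.mul_assoc, h0, Matrix.zero_mul, Matrix.zero_mul]
  have hZQ : Z' * Q = 0 := by
    rw [hQs] at hQQ
    have h0 : (1 - Q) * Q = 0 := by rw [Matrix.sub_mul, Matrix.one_mul, hQQ, sub_self]
    rw [hZ', Matrix.mul_assoc, h0, Matrix.mul_zero]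
  -- `W + Z'` is a subgradient at `A`: its pairing with `A + H` is `‖A‖_* + tr(WᵀH) + ‖H'‖_*`. With
  -- the descent hypothesis this gives `‖H'‖_* ≤ |tr(WᵀH)|`.
  have hc := (hWc.add_of_orthogonal hZ'c hQQ hWZ hWQ hZQ).trace_le_nuclearNorm (A + H)
  have hZ't : Z'ᵀ = (1 - Q) * (Zᵀ * (1 - P)) := by
    simp only [hZ', transpose_mul, transpose_sub, transpose_one, hPs, hQs]
  have hZA : (Z'ᵀ * A) = 0 := by
    have h0 : (1 - P) * A = 0 := by rw [Matrix.sub_mul, hWA, Matrix.one_mul, sub_self]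
    rw [hZ't, Matrix.mul_assoc, Matrix.mul_assoc, h0, Matrix.mul_zero, Matrix.mul_zero]
  have hZH : (Z'ᵀ * H).trace = nuclearNorm H' := by
    rw [← hZt, hZ't, Matrix.mul_assoc, Matrix.trace_mul_comm, hH']
    simp only [Matrix.mul_assoc]
  rw [transpose_add, Matrix.add_mul, Matrix.mul_add, Matrix.mul_add, trace_add, trace_add,
    trace_add, ht, hZA, hZH, trace_zero] at hc
  have hWH := (abs_le.mp (abs_trace_transpose_mul_le W H)).1
  have h1 : nuclearNorm H' ≤ √r * ‖H‖ := by
    have := mul_le_mul_of_nonneg_right hWn (norm_nonneg H)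
    linarith
  have h2 : nuclearNorm (P * H) ≤ √r * ‖H‖ :=
    (nuclearNorm_mul_le_left P H).trans (mul_le_mul_of_nonneg_right hPn (norm_nonneg _))
  have h3 : nuclearNorm ((1 - P) * H * Q) ≤ √r * ‖H‖ := by
    refine (nuclearNorm_mul_le_right _ Q).trans ?_
    rw [mul_comm]
    exact mul_le_mul hQn (norm_one_sub_projection_mul_le hPP H) (norm_nonneg _) (by positivity)
  -- Three pieces, each of nuclear norm at most `√r * ‖H‖`: hence the factor 3.
  have hsum : H = H' + (P * H + (1 - P) * H * Q) := by
    rw [hH', Matrix.mul_sub, Matrix.mul_one, Matrix.sub_mul, Matrix.one_mul]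
    abel
  have h4 := nuclearNorm_add_le H' (P * H + (1 - P) * H * Q)
  have h5 := nuclearNorm_add_le (P * H) ((1 - P) * H * Q)
  rw [← hsum] at h4
  linarith

end Cone

/-! ### Blocks of singular values. -/

section Blocks

variable {p₁ p₂ : ℕ}

theorem sum_range_mul_eq {M : Type*} [AddCommMonoid M] (g : ℕ → M) (J m : ℕ) :
    ∑ i ∈ Finset.range (J * m), g i =
      ∑ j ∈ Finset.range J, ∑ a : Fin m, g (j * m + a) := by
  induction J with
  | zero => simp
  | succ J ih =>
    rw [Nat.succ_mul, Finset.sum_range_add, ih, Finset.sum_range_succ,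
      Finset.sum_range fun a => g (J * m + a)]

theorem sv_eq_zero (A : Matrix (Fin p₁) (Fin p₂) ℝ) {i : ℕ} (h : p₂ ≤ i) : A.sv i = 0 :=
  LinearMap.singularValues_of_finrank_le _ (by simpa using h)

/-- Splitting the singular value decomposition into blocks of `m` consecutive singular values. -/
theorem exists_svd_blocks (H : Matrix (Fin p₁) (Fin p₂) ℝ) {m : ℕ} (hm : 0 < m) :
    ∃ B : ℕ → Matrix (Fin p₂) (Fin m) ℝ, (∀ j, (B j).IsContraction) ∧
      ∑ j ∈ Finset.range (p₂ + 1), H * B j * (B j)ᵀ = H ∧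
      ∑ j ∈ Finset.range p₂, ‖H * B (j + 1)‖ ≤ nuclearNorm H / √m := by
  obtain ⟨V, hV, hV', hd⟩ := exists_rightSingularVectors H
  -- Columns with index beyond `p₂` are zero, so `m` need not divide `p₂` and may exceed it; `p₂ +
  -- 1` blocks always suffice as `m ≥ 1`.
  let B : ℕ → Matrix (Fin p₂) (Fin m) ℝ := fun j =>
    Matrix.of fun k a => if h : j * m + a < p₂ then V k ⟨j * m + a, h⟩ else 0
  have hVV : ∀ i j, ∑ k, V k i * V k j = if i = j then 1 else 0 := by
    intro i j
    simpa [Matrix.mul_apply, Matrix.one_apply] using congrFun (congrFun hV i) j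
  have hB : ∀ j, (B j).IsContraction := by
    intro j
    refine IsContraction.of_gram_eq_diagonal
      (d := fun a => if j * m + a < p₂ then 1 else 0) ?_ (fun a => by split_ifs <;> simp)
    ext a b
    simp only [Matrix.mul_apply, transpose_apply, B, of_apply, diagonal_apply]
    by_cases ha : j * m + a < p₂
    · by_cases hb : j * m + b < p₂
      · simp only [ha, hb, dif_pos, if_true]
        rw [hVV]
        simp [Fin.ext_iff]
      · have : a ≠ b := by rintro rfl; exact hb ha
        simp [hb, this]
    · simp [ha]
  have hn : ∀ j, ‖H * B j‖ ^ 2 = ∑ a : Fin m, H.sv (j * m + a) ^ 2 := by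
    intro j
    rw [frobenius_sq_trace, trace]
    refine Finset.sum_congr rfl fun a _ => ?_
    by_cases ha : j * m + a < p₂
    · have e := congrFun (congrFun hd ⟨j * m + a, ha⟩) ⟨j * m + a, ha⟩
      have e2 : Vᵀ * (Hᵀ * H) * V = (H * V)ᵀ * (H * V) := by
        rw [transpose_mul]; simp only [Matrix.mul_assoc]
      rw [e2, diagonal_apply_eq] at e
      rw [← e]
      simp [Matrix.mul_apply, B, ha]
    · rw [sv_eq_zero H (not_lt.mp ha)]
      simp [Matrix.mul_apply, B, ha]
  refine ⟨B, hB, ?_, ?_⟩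
  · simp only [Matrix.mul_assoc]
    rw [← Matrix.mul_sum]
    have : ∑ j ∈ Finset.range (p₂ + 1), B j * (B j)ᵀ = 1 := by
      rw [← hV']
      ext k k'
      let g : ℕ → ℝ := fun i => if h : i < p₂ then V k ⟨i, h⟩ * V k' ⟨i, h⟩ else 0
      have h1 : (∑ j ∈ Finset.range (p₂ + 1), B j * (B j)ᵀ) k k' =
          ∑ i ∈ Finset.range ((p₂ + 1) * m), g i := by
        rw [sum_range_mul_eq, Matrix.sum_apply]
        refine Finset.sum_congr rfl fun j _ => ?_
        rw [Matrix.mul_apply]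
        refine Finset.sum_congr rfl fun a _ => ?_
        by_cases ha : j * m + a < p₂ <;> simp [B, g, ha]
      have h2 : ∑ i ∈ Finset.range p₂, g i = ∑ i ∈ Finset.range ((p₂ + 1) * m), g i := by
        refine Finset.sum_subset (Finset.range_mono (by nlinarith)) fun i _ hi => ?_
        simp only [Finset.mem_range] at hi
        simp [g, hi]
      rw [h1, ← h2, Finset.sum_range, Matrix.mul_apply]
      refine Finset.sum_congr rfl fun i _ => ?_
      simp [g]
    rw [this, Matrix.mul_one]
  · have hm' : (0 : ℝ) < m := by exact_mod_cast hm
    -- By monotonicity every singular value in block `j + 1` is at most the average over block `j`.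
    have hstep : ∀ j, ‖H * B (j + 1)‖ ≤ (∑ a : Fin m, H.sv (j * m + a)) / √m := by
      intro j
      set S := ∑ a : Fin m, H.sv (j * m + a)
      have hS : 0 ≤ S := Finset.sum_nonneg fun a _ => sv_nonneg _ _
      refine le_of_sq_le_sq ?_ (by positivity)
      rw [hn, div_pow, Real.sq_sqrt hm'.le]
      have hle : ∀ a : Fin m, H.sv ((j + 1) * m + a) ≤ S / m := by
        intro a
        rw [le_div_iff₀ hm']
        have : ∑ _b : Fin m, H.sv ((j + 1) * m + a) ≤ S := by
          refine Finset.sum_le_sum fun b _ => ?_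
          apply LinearMap.singularValues_antitone
          have := b.2
          rw [Nat.succ_mul]
          omega
        simpa [mul_comm] using this
      calc ∑ a : Fin m, H.sv ((j + 1) * m + a) ^ 2 ≤ ∑ _a : Fin m, (S / m) ^ 2 :=
            Finset.sum_le_sum fun a _ => pow_le_pow_left₀ (sv_nonneg _ _) (hle a) 2
        _ = S ^ 2 / m := by
            simp only [Finset.sum_const, Finset.card_univ, Fintype.card_fin, nsmul_eq_mul]
            field_simp
    refine (Finset.sum_le_sum fun j _ => hstep j).trans ?_
    rw [← Finset.sum_div, ← sum_range_mul_eq]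
    refine div_le_div_of_nonneg_right (le_of_eq ?_) (by positivity)
    refine (Finset.sum_subset (Finset.range_mono (by nlinarith)) fun i _ hi => ?_).symm
    exact sv_eq_zero H (by simpa using hi)

end Blocks

/-! ### Nets of unit balls. -/

section Nets

/-- Volume comparison: the balls of radius `ε / 2` around the points are disjoint and lie in the
ball of radius `3 / 2`. -/
theorem separated_card_le {E : Type*} [NormedAddCommGroup E] [NormedSpace ℝ E]
    [FiniteDimensional ℝ E] {ε : ℝ} (hε : 0 < ε) (hε1 : ε ≤ 1) (s : Finset E)
    (hs : ∀ x ∈ s, ‖x‖ ≤ 1) (hsep : ∀ x ∈ s, ∀ y ∈ s, x ≠ y → ε ≤ ‖x - y‖) :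
    (s.card : ℝ) ≤ (3 / ε) ^ Module.finrank ℝ E := by
  borelize E
  let μ : Measure E := Measure.addHaar
  set d := Module.finrank ℝ E
  let A : Set E := ⋃ x ∈ s, Metric.ball x (ε / 2)
  have D : Set.Pairwise (s : Set E) (Function.onFun Disjoint fun c => Metric.ball c (ε / 2)) := by
    rintro c hc e he hce
    apply Metric.ball_disjoint_ball
    rw [dist_eq_norm]
    have := hsep c hc e he hce
    linarith
  have hsub : A ⊆ Metric.ball (0 : E) (3 / 2) := by
    refine Set.iUnion₂_subset fun x hx => Metric.ball_subset_ball' ?_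
    rw [dist_zero_right]
    have := hs x hx
    linarith
  have I : (s.card : ENNReal) * ENNReal.ofReal ((ε / 2) ^ d) * μ (Metric.ball 0 1)
      ≤ ENNReal.ofReal ((3 / 2) ^ d) * μ (Metric.ball 0 1) := by
    calc (s.card : ENNReal) * ENNReal.ofReal ((ε / 2) ^ d) * μ (Metric.ball 0 1) = μ A := by
          rw [measure_biUnion_finset D fun c _ => measurableSet_ball]
          have : ∀ x ∈ s, μ (Metric.ball x (ε / 2)) =
              ENNReal.ofReal ((ε / 2) ^ d) * μ (Metric.ball 0 1) :=
            fun x _ => μ.addHaar_ball_of_pos x (by positivity)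
          rw [Finset.sum_congr rfl this, Finset.sum_const, nsmul_eq_mul, mul_assoc]
      _ ≤ μ (Metric.ball (0 : E) (3 / 2)) := measure_mono hsub
      _ = _ := μ.addHaar_ball_of_pos 0 (by norm_num)
  have J : (s.card : ENNReal) * ENNReal.ofReal ((ε / 2) ^ d) ≤ ENNReal.ofReal ((3 / 2) ^ d) :=
    (ENNReal.mul_le_mul_iff_left (Metric.measure_ball_pos _ _ zero_lt_one).ne'
      measure_ball_lt_top.ne).1 I
  rw [← ENNReal.ofReal_natCast, ← ENNReal.ofReal_mul (by positivity),
    ENNReal.ofReal_le_ofReal_iff (by positivity)] at J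
  have e : (3 / ε) ^ d = (3 / 2) ^ d / (ε / 2) ^ d := by
    rw [← div_pow]; congr 1; field_simp
  rw [e, le_div_iff₀ (by positivity)]
  exact J

/-- Nets of unit balls of finite dimensional spaces. -/
theorem exists_net_unitBall (E : Type*) [NormedAddCommGroup E] [NormedSpace ℝ E]
    [FiniteDimensional ℝ E] {ε : ℝ} (hε : 0 < ε) (hε1 : ε ≤ 1) :
    ∃ N : Finset E, (N.card : ℝ) ≤ (3 / ε) ^ Module.finrank ℝ E ∧ (∀ y ∈ N, ‖y‖ ≤ 1) ∧
      ∀ x : E, ‖x‖ ≤ 1 → ∃ y ∈ N, ‖x - y‖ ≤ ε := by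
  classical
  -- A separated set of maximal cardinality is a net; the volume bound ensures that the maximum is
  -- attained.
  let S : Finset E → Prop := fun s => (∀ x ∈ s, ‖x‖ ≤ 1) ∧
    ∀ x ∈ s, ∀ y ∈ s, x ≠ y → ε ≤ ‖x - y‖
  let T : Set ℕ := {k | ∃ s, S s ∧ s.card = k}
  have hT : T.Nonempty := ⟨0, ∅, ⟨by simp, by simp⟩, rfl⟩
  have hbdd : BddAbove T := by
    refine ⟨⌊(3 / ε) ^ Module.finrank ℝ E⌋₊, ?_⟩
    rintro k ⟨s, hs, rfl⟩
    exact Nat.le_floor (separated_card_le hε hε1 s hs.1 hs.2)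
  obtain ⟨N, hN, hcard⟩ := Nat.sSup_mem hT hbdd
  refine ⟨N, separated_card_le hε hε1 N hN.1 hN.2, hN.1, fun x hx => ?_⟩
  by_contra! hfar
  have hxN : x ∉ N := fun h => by
    have := hfar x h
    simp at this
    linarith
  have hins : S (insert x N) := by
    refine ⟨?_, ?_⟩
    · intro y hy
      rcases Finset.mem_insert.mp hy with rfl | hy
      · exact hx
      · exact hN.1 y hy
    · intro y hy z hz hyz
      rcases Finset.mem_insert.mp hy with rfl | hy' <;> rcases Finset.mem_insert.mp hz with rfl | hz'
      · exact absurd rfl hyz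
      · exact (hfar z hz').le
      · rw [norm_sub_rev]; exact (hfar y hy').le
      · exact hN.2 y hy' z hz' hyz
  have : (insert x N).card ≤ sSup T := le_csSup hbdd ⟨_, hins, rfl⟩
  rw [Finset.card_insert_of_notMem hxN] at this
  omega

theorem exists_net_frobenius (a b : ℕ) {ε : ℝ} (hε : 0 < ε) (hε1 : ε ≤ 1) :
    ∃ N : Finset (Matrix (Fin a) (Fin b) ℝ), (N.card : ℝ) ≤ (3 / ε) ^ (a * b) ∧
      (∀ y ∈ N, ‖y‖ ≤ 1) ∧ ∀ x : Matrix (Fin a) (Fin b) ℝ, ‖x‖ ≤ 1 → ∃ y ∈ N, ‖x - y‖ ≤ ε := by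
  have := exists_net_unitBall (Matrix (Fin a) (Fin b) ℝ) hε hε1
  rwa [show Module.finrank ℝ (Matrix (Fin a) (Fin b) ℝ) = a * b by
    simp [Module.finrank_matrix]] at this

theorem toLp_norm_sq {k : ℕ} (x : Fin k → ℝ) : ‖WithLp.toLp 2 x‖ ^ 2 = x ⬝ᵥ x := by
  rw [EuclideanSpace.real_norm_sq_eq]
  simp [dotProduct, sq]

theorem isContraction_smul_iff {a b : ℕ} (W : Matrix (Fin a) (Fin b) ℝ) {c : ℝ} (hc : 0 < c) :
    (c⁻¹ • W).IsContraction ↔ ‖LinearMap.toContinuousLinearMap (Matrix.toEuclideanLin W)‖ ≤ c := by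
  have key : ∀ x : Fin b → ℝ,
      ((c⁻¹ • W) *ᵥ x) ⬝ᵥ ((c⁻¹ • W) *ᵥ x) ≤ x ⬝ᵥ x ↔
        ‖LinearMap.toContinuousLinearMap (Matrix.toEuclideanLin W) (WithLp.toLp 2 x)‖ ≤
          c * ‖WithLp.toLp 2 x‖ := by
    intro x
    rw [← sq_le_sq₀ (norm_nonneg _) (by positivity), mul_pow, toLp_norm_sq]
    have : LinearMap.toContinuousLinearMap (Matrix.toEuclideanLin W) (WithLp.toLp 2 x)
      = WithLp.toLp 2 (W *ᵥ x) := rfl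
    rw [this, toLp_norm_sq, Matrix.smul_mulVec, smul_dotProduct, dotProduct_smul, smul_eq_mul,
      smul_eq_mul, ← mul_assoc, ← sq, inv_pow, inv_mul_le_iff₀ (by positivity)]
  constructor
  · intro h
    exact ContinuousLinearMap.opNorm_le_bound _ hc.le fun x => (key x.ofLp).mp (h _)
  · intro h x
    exact (key x).mpr (ContinuousLinearMap.le_of_opNorm_le _ h _)

/-- Contractions form the operator-norm unit ball, so a net in that norm costs no dimensional
factor; their Frobenius norm can be as large as the square root of the smaller dimension. -/
theorem exists_net_contraction (a b : ℕ) {ε : ℝ} (hε : 0 < ε) (hε1 : ε ≤ 1) :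
    ∃ N : Finset (Matrix (Fin a) (Fin b) ℝ), (N.card : ℝ) ≤ (3 / ε) ^ (a * b) ∧
      (∀ y ∈ N, y.IsContraction) ∧ ∀ x : Matrix (Fin a) (Fin b) ℝ, x.IsContraction →
        ∃ y ∈ N, (ε⁻¹ • (x - y)).IsContraction := by
  classical
  obtain ⟨N, hcard, hN, hnet⟩ := exists_net_unitBall
    (EuclideanSpace ℝ (Fin b) →L[ℝ] EuclideanSpace ℝ (Fin a)) hε hε1
  let e : Matrix (Fin a) (Fin b) ℝ ≃ₗ[ℝ]
      (EuclideanSpace ℝ (Fin b) →L[ℝ] EuclideanSpace ℝ (Fin a)) :=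
    Matrix.toEuclideanLin.trans LinearMap.toContinuousLinearMap
  have h1 : ∀ W : Matrix (Fin a) (Fin b) ℝ, W.IsContraction ↔ ‖e W‖ ≤ 1 := fun W => by
    have := isContraction_smul_iff W one_pos
    rwa [inv_one, one_smul] at this
  have hfin : Module.finrank ℝ (EuclideanSpace ℝ (Fin b) →L[ℝ] EuclideanSpace ℝ (Fin a)) = a * b := by
    rw [← e.finrank_eq]; simp [Module.finrank_matrix]
  rw [hfin] at hcard
  refine ⟨N.image e.symm, le_trans (by exact_mod_cast Finset.card_image_le) hcard, ?_, ?_⟩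
  · intro y hy
    obtain ⟨z, hz, rfl⟩ := Finset.mem_image.mp hy
    rw [h1, e.apply_symm_apply]
    exact hN z hz
  · intro x hx
    obtain ⟨z, hz, hxz⟩ := hnet (e x) ((h1 x).mp hx)
    refine ⟨e.symm z, Finset.mem_image_of_mem _ hz, ?_⟩
    rw [isContraction_smul_iff _ hε]
    change ‖e (x - e.symm z)‖ ≤ ε
    rwa [map_sub, e.apply_symm_apply]

end Nets

/-! ### From bounds on nets to exact recovery. -/

section Deterministic

variable {p₁ p₂ m : ℕ}

/-- Only finiteness matters: it makes the supremum in `Seminorm.factor_upper` meaningful. -/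
theorem Seminorm.exists_frobenius_bound (f : Seminorm ℝ (Matrix (Fin p₁) (Fin p₂) ℝ)) :
    ∃ S, ∀ D, ‖D‖ ≤ 1 → f D ≤ S := by
  refine ⟨∑ i, ∑ j, f (Matrix.single i j 1), fun D hD => ?_⟩
  have hentry : ∀ i j, |D i j| ≤ 1 := by
    intro i j
    rw [← sq_le_one_iff_abs_le_one]
    have h1 : ‖D‖ ^ 2 ≤ 1 := pow_le_one₀ (norm_nonneg _) hD
    rw [frobenius_sq] at h1
    refine le_trans ?_ h1
    refine le_trans ?_ (Finset.single_le_sum (f := fun i => ∑ j, D i j ^ 2)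
      (fun i _ => Finset.sum_nonneg fun j _ => sq_nonneg _) (Finset.mem_univ i))
    exact Finset.single_le_sum (f := fun j => D i j ^ 2) (fun j _ => sq_nonneg _)
      (Finset.mem_univ j)
  have hsum : ∀ (ι : Type) (s : Finset ι) (g : ι → Matrix (Fin p₁) (Fin p₂) ℝ),
      f (∑ i ∈ s, g i) ≤ ∑ i ∈ s, f (g i) := fun ι s g =>
    Finset.le_sum_of_subadditive f (map_zero f).le (map_add_le_add f) s g
  conv_lhs => rw [Matrix.matrix_eq_sum_single D]
  refine (hsum _ _ _).trans (Finset.sum_le_sum fun i _ => (hsum _ _ _).trans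
    (Finset.sum_le_sum fun j _ => ?_))
  have : Matrix.single i j (D i j) = D i j • Matrix.single i j (1 : ℝ) := by
    rw [Matrix.smul_single, smul_eq_mul, mul_one]
  rw [this, map_smul_eq_mul, Real.norm_eq_abs]
  exact mul_le_of_le_one_left (apply_nonneg f _) (hentry i j)

/-- Passing from nets to all factorizations: upper bound. -/
theorem Seminorm.factor_upper (f : Seminorm ℝ (Matrix (Fin p₁) (Fin p₂) ℝ)) {ε t : ℝ}
    (hε : 0 < ε) (hε1 : ε ≤ 1 / 4)
    {NA : Finset (Matrix (Fin p₁) (Fin m) ℝ)} {NB : Finset (Matrix (Fin p₂) (Fin m) ℝ)}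
    (hNA : ∀ x : Matrix (Fin p₁) (Fin m) ℝ, ‖x‖ ≤ 1 → ∃ y ∈ NA, ‖x - y‖ ≤ ε)
    (hNA1 : ∀ y ∈ NA, ‖y‖ ≤ 1)
    (hNB : ∀ x : Matrix (Fin p₂) (Fin m) ℝ, x.IsContraction →
      ∃ y ∈ NB, (ε⁻¹ • (x - y)).IsContraction)
    (hf : ∀ A ∈ NA, ∀ B ∈ NB, f (A * Bᵀ) ≤ t) :
    ∀ (A : Matrix (Fin p₁) (Fin m) ℝ) (B : Matrix (Fin p₂) (Fin m) ℝ), B.IsContraction →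
      f (A * Bᵀ) ≤ 2 * t * ‖A‖ := by
  obtain ⟨S₀, hS₀⟩ := f.exists_frobenius_bound
  let G : Set ℝ := {v | ∃ (A : Matrix (Fin p₁) (Fin m) ℝ) (B : Matrix (Fin p₂) (Fin m) ℝ),
    ‖A‖ ≤ 1 ∧ B.IsContraction ∧ v = f (A * Bᵀ)}
  have hbdd : BddAbove G := by
    refine ⟨S₀, ?_⟩
    rintro v ⟨A, B, hA, hB, rfl⟩
    exact hS₀ _ ((hB.norm_mul_transpose_le A).trans hA)
  have hne : G.Nonempty := ⟨_, 0, 0, by simp, by intro x; simp [real_dotProduct_self_nonneg], rfl⟩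
  set S := sSup G
  have hle : ∀ (A : Matrix (Fin p₁) (Fin m) ℝ) (B : Matrix (Fin p₂) (Fin m) ℝ), ‖A‖ ≤ 1 →
      B.IsContraction → f (A * Bᵀ) ≤ S := fun A B hA hB => le_csSup hbdd ⟨A, B, hA, hB, rfl⟩
  -- Both error terms are `ε` times an admissible product, so the supremum bounds itself; `ε ≤ 1 /
  -- 4` then gives `S ≤ 2 * t`.
  have hS : S ≤ t + 2 * ε * S := by
    refine csSup_le hne ?_
    rintro v ⟨A, B, hA, hB, rfl⟩
    obtain ⟨A', hA', hAA⟩ := hNA A hA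
    obtain ⟨B', hB', hBB⟩ := hNB B hB
    have e : A * Bᵀ = A' * B'ᵀ + (ε • ((ε⁻¹ • (A - A')) * Bᵀ) + ε • (A' * (ε⁻¹ • (B - B'))ᵀ)) := by
      rw [transpose_smul, Matrix.mul_smul, Matrix.smul_mul, smul_smul, smul_smul,
        mul_inv_cancel₀ hε.ne', one_smul, one_smul, transpose_sub, Matrix.sub_mul, Matrix.mul_sub]
      abel
    have h1 : f ((ε⁻¹ • (A - A')) * Bᵀ) ≤ S := by
      refine hle _ _ ?_ hB
      rw [norm_smul, Real.norm_eq_abs, abs_of_pos (inv_pos.mpr hε), inv_mul_le_iff₀ hε, mul_one]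
      exact hAA
    have h2 : f (A' * (ε⁻¹ • (B - B'))ᵀ) ≤ S := hle _ _ (hNA1 _ hA') hBB
    rw [e]
    refine (map_add_le_add f _ _).trans ?_
    have h3 := map_add_le_add f (ε • ((ε⁻¹ • (A - A')) * Bᵀ)) (ε • (A' * (ε⁻¹ • (B - B'))ᵀ))
    rw [map_smul_eq_mul, map_smul_eq_mul, Real.norm_eq_abs, abs_of_pos hε] at h3
    have := hf A' hA' B' hB'
    nlinarith
  have hS0 : 0 ≤ S := by
    obtain ⟨v, hv⟩ := hne
    refine le_trans ?_ (le_csSup hbdd hv)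
    obtain ⟨A, B, -, -, rfl⟩ := hv
    exact apply_nonneg f _
  have hS2 : S ≤ 2 * t := by nlinarith
  intro A B hB
  by_cases hA : A = 0
  · simp [hA]
  have hA' : 0 < ‖A‖ := norm_pos_iff.mpr hA
  have := hle (‖A‖⁻¹ • A) B (by rw [norm_smul, norm_inv, norm_norm, inv_mul_cancel₀ hA'.ne']) hB
  rw [Matrix.smul_mul, map_smul_eq_mul, norm_inv, norm_norm, inv_mul_le_iff₀ hA'] at this
  nlinarith

/-- Passing from nets to all factorizations: lower bound. -/
theorem Seminorm.factor_lower (f : Seminorm ℝ (Matrix (Fin p₁) (Fin p₂) ℝ)) {ε t c : ℝ}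
    (hε : 0 < ε) (hc : 0 ≤ c)
    {NA : Finset (Matrix (Fin p₁) (Fin m) ℝ)} {NB : Finset (Matrix (Fin p₂) (Fin m) ℝ)}
    (hNA : ∀ x : Matrix (Fin p₁) (Fin m) ℝ, ‖x‖ ≤ 1 → ∃ y ∈ NA, ‖x - y‖ ≤ ε)
    (hNA1 : ∀ y ∈ NA, ‖y‖ ≤ 1)
    (hNB : ∀ x : Matrix (Fin p₂) (Fin m) ℝ, x.IsContraction →
      ∃ y ∈ NB, (ε⁻¹ • (x - y)).IsContraction)
    (hf : ∀ A ∈ NA, ∀ B ∈ NB, c * ‖A * Bᵀ‖ ≤ f (A * Bᵀ))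
    (hup : ∀ (A : Matrix (Fin p₁) (Fin m) ℝ) (B : Matrix (Fin p₂) (Fin m) ℝ), B.IsContraction →
      f (A * Bᵀ) ≤ t * ‖A‖) (ht : 0 ≤ t) :
    ∀ (A : Matrix (Fin p₁) (Fin m) ℝ) (B : Matrix (Fin p₂) (Fin m) ℝ), B.IsContraction →
      c * ‖A * Bᵀ‖ - 2 * (c + t) * ε * ‖A‖ ≤ f (A * Bᵀ) := by
  have unit : ∀ (A : Matrix (Fin p₁) (Fin m) ℝ) (B : Matrix (Fin p₂) (Fin m) ℝ), ‖A‖ ≤ 1 →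
      B.IsContraction → c * ‖A * Bᵀ‖ - 2 * (c + t) * ε ≤ f (A * Bᵀ) := by
    intro A B hA hB
    obtain ⟨A', hA', hAA⟩ := hNA A hA
    obtain ⟨B', hB', hBB⟩ := hNB B hB
    have e : A * Bᵀ - A' * B'ᵀ = (A - A') * Bᵀ + ε • (A' * (ε⁻¹ • (B - B'))ᵀ) := by
      rw [transpose_smul, Matrix.mul_smul, smul_smul, mul_inv_cancel₀ hε.ne', one_smul,
        transpose_sub, Matrix.sub_mul, Matrix.mul_sub]
      abel
    have hA'1 := hNA1 A' hA'
    have n1 : ‖A * Bᵀ - A' * B'ᵀ‖ ≤ 2 * ε := by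
      rw [e]
      refine (norm_add_le _ _).trans ?_
      rw [norm_smul, Real.norm_eq_abs, abs_of_pos hε]
      have h1 := (hB.norm_mul_transpose_le (A - A')).trans hAA
      have h2 := (hBB.norm_mul_transpose_le A').trans hA'1
      nlinarith
    have f1 : f (A * Bᵀ - A' * B'ᵀ) ≤ 2 * t * ε := by
      rw [e]
      refine (map_add_le_add f _ _).trans ?_
      rw [map_smul_eq_mul, Real.norm_eq_abs, abs_of_pos hε]
      have h1 := (hup (A - A') B hB).trans (mul_le_mul_of_nonneg_left hAA ht)
      have h2 := (hup A' _ hBB).trans (mul_le_mul_of_nonneg_left hA'1 ht)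
      nlinarith
    have n2 : ‖A * Bᵀ‖ ≤ ‖A' * B'ᵀ‖ + 2 * ε := by
      have := norm_sub_norm_le (A * Bᵀ) (A' * B'ᵀ)
      linarith
    have f2 : f (A' * B'ᵀ) ≤ f (A * Bᵀ) + 2 * t * ε := by
      have h : A' * B'ᵀ = A * Bᵀ - (A * Bᵀ - A' * B'ᵀ) := by abel
      have := map_sub_le_add f (A * Bᵀ) (A * Bᵀ - A' * B'ᵀ)
      rw [← h] at this
      linarith
    have := hf A' hA' B' hB'
    nlinarith
  intro A B hB
  by_cases hA : A = 0
  · simp [hA]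
  have hA' : 0 < ‖A‖ := norm_pos_iff.mpr hA
  have := unit (‖A‖⁻¹ • A) B (by rw [norm_smul, norm_inv, norm_norm, inv_mul_cancel₀ hA'.ne']) hB
  rw [Matrix.smul_mul, map_smul_eq_mul, norm_smul, norm_inv, norm_norm, ← sub_nonneg] at this
  have h2 := mul_nonneg hA'.le this
  have h3 : ‖A‖ * ‖A‖⁻¹ = 1 := mul_inv_cancel₀ hA'.ne'
  have h4 : ‖A‖ * (‖A‖⁻¹ * f (A * Bᵀ) - (c * (‖A‖⁻¹ * ‖A * Bᵀ‖) - 2 * (c + t) * ε))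
    = (‖A‖ * ‖A‖⁻¹) * (f (A * Bᵀ) - c * ‖A * Bᵀ‖) + 2 * (c + t) * ε * ‖A‖ := by ring
  rw [h4, h3] at h2
  linarith

/-- A seminorm that is well-conditioned on matrices with factorizations of width `m` vanishes at
no nonzero matrix of effective rank much smaller than `m`. -/
theorem Seminorm.eq_zero_of_factor_bounds (f : Seminorm ℝ (Matrix (Fin p₁) (Fin p₂) ℝ))
    {c t η θ : ℝ} (hc : 0 ≤ c) (ht : 0 ≤ t) (hη : 0 ≤ η) (hm : 0 < m)
    (hup : ∀ (A : Matrix (Fin p₁) (Fin m) ℝ) (B : Matrix (Fin p₂) (Fin m) ℝ), B.IsContraction →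
      f (A * Bᵀ) ≤ t * ‖A‖)
    (hlow : ∀ (A : Matrix (Fin p₁) (Fin m) ℝ) (B : Matrix (Fin p₂) (Fin m) ℝ), B.IsContraction →
      c * ‖A * Bᵀ‖ - η * ‖A‖ ≤ f (A * Bᵀ))
    (hθ : (c + t) * θ + η < c) {H : Matrix (Fin p₁) (Fin p₂) ℝ}
    (hH : nuclearNorm H ≤ θ * √m * ‖H‖) (hf : f H = 0) : H = 0 := by
  obtain ⟨B, hB, hsum, htail⟩ := exists_svd_blocks H hm
  have hm' : 0 < √(m : ℝ) := Real.sqrt_pos.mpr (by exact_mod_cast hm)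
  have htail' : ∑ j ∈ Finset.range p₂, ‖H * B (j + 1)‖ ≤ θ * ‖H‖ := by
    refine htail.trans ?_
    rw [div_le_iff₀ hm']
    linarith
  rw [Finset.sum_range_succ'] at hsum
  set R := ∑ j ∈ Finset.range p₂, H * B (j + 1) * (B (j + 1))ᵀ
  have hRn : ‖R‖ ≤ θ * ‖H‖ := (norm_sum_le _ _).trans
    ((Finset.sum_le_sum fun j _ => (hB (j + 1)).norm_mul_transpose_le _).trans htail')
  have hRf : f R ≤ t * (θ * ‖H‖) := by
    refine (Finset.le_sum_of_subadditive f (map_zero f).le (map_add_le_add f) _ _).trans ?_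
    refine (Finset.sum_le_sum fun j _ => hup _ _ (hB (j + 1))).trans ?_
    rw [← Finset.mul_sum]
    exact mul_le_mul_of_nonneg_left htail' ht
  -- As `f H = 0`, the leading block has `f (H - R) ≤ f R ≤ t * θ * ‖H‖`, while `hlow` bounds it
  -- below by `(c * (1 - θ) - η) * ‖H‖`; `hθ` makes these incompatible unless `H = 0`.
  have h1 : H * B 0 * (B 0)ᵀ = H - R := eq_sub_of_add_eq' hsum
  have h2 := hlow (H * B 0) (B 0) (hB 0)
  rw [h1] at h2
  have h3 : ‖H * B 0‖ ≤ ‖H‖ := (hB 0).norm_mul_le H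
  have h4 := norm_sub_norm_le H R
  have h5 := map_sub_le_add f H R
  rw [hf] at h5
  by_contra hne
  have hpos : 0 < ‖H‖ := norm_pos_iff.mpr hne
  have h6 : c * (‖H‖ - ‖R‖) ≤ c * ‖H - R‖ := mul_le_mul_of_nonneg_left h4 hc
  have h7 := mul_le_mul_of_nonneg_left hRn hc
  have h8 := mul_le_mul_of_nonneg_left h3 hη
  have h9 := mul_lt_mul_of_pos_right hθ hpos
  linarith

/-- A feasible matrix of no larger nuclear norm equals `A`, which gives both uniqueness and
minimality of `A`; no compactness argument is needed. -/
theorem recoversRank_of_cone {n r : ℕ} (𝒳 : Matrix (Fin p₁) (Fin p₂) ℝ →ₗ[ℝ] (Fin n → ℝ))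
    (h : ∀ H, nuclearNorm H ≤ 3 * √r * ‖H‖ → 𝒳 H = 0 → H = 0) : RecoversRank 𝒳 r := by
  intro A hA M
  have key : ∀ M', 𝒳 M' = 𝒳 A → nuclearNorm M' ≤ nuclearNorm A → M' = A := by
    intro M' hM' hle
    rw [← sub_eq_zero]
    refine h _ (nuclearNorm_le_of_descent hA ?_) (by rw [map_sub, hM', sub_self])
    rwa [add_sub_cancel]
  constructor
  · rintro ⟨hM, hmin⟩
    exact key M hM (hmin A rfl)
  · rintro rfl
    refine ⟨rfl, fun M' hM' => ?_⟩
    by_contra! hlt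
    rw [key M' hM' hlt.le] at hlt
    exact lt_irrefl _ hlt

end Deterministic

/-! ### Linear forms of a Gaussian vector. -/

section GaussianForms

/-- The standard Gaussian measure on `ℝ^k`. -/
noncomputable abbrev stdGauss (k : ℕ) : Measure (Fin k → ℝ) :=
  Measure.pi fun _ => gaussianReal 0 1

theorem stdGauss_map_dotProduct {k : ℕ} (w : Fin k → ℝ) :
    (stdGauss k).map (fun x => x ⬝ᵥ w) = gaussianReal 0 (w ⬝ᵥ w).toNNReal := by
  apply Measure.ext_of_charFun
  ext t
  rw [charFun_apply_real, integral_map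
    (Measurable.aemeasurable (by unfold dotProduct; fun_prop)) (by fun_prop), charFun_gaussianReal]
  have e : ∀ x : Fin k → ℝ, Complex.exp (t * ((x ⬝ᵥ w : ℝ) : ℂ) * Complex.I) =
      ∏ i, Complex.exp (((t * w i : ℝ) : ℂ) * (x i : ℂ) * Complex.I) := by
    intro x
    rw [← Complex.exp_sum, dotProduct, Complex.ofReal_sum, Finset.mul_sum, Finset.sum_mul]
    congr 1
    refine Finset.sum_congr rfl fun i _ => ?_
    push_cast
    ring
  simp_rw [e]
  rw [integral_fintype_prod_eq_prod
    (fun i (y : ℝ) => Complex.exp (((t * w i : ℝ) : ℂ) * (y : ℂ) * Complex.I))]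
  have h1 : ∀ i, ∫ y : ℝ, Complex.exp (((t * w i : ℝ) : ℂ) * (y : ℂ) * Complex.I)
      ∂(gaussianReal 0 1) = Complex.exp (-((t * w i : ℝ) : ℂ) ^ 2 / 2) := by
    intro i
    rw [← charFun_apply_real, charFun_gaussianReal]
    congr 1
    simp
    ring
  simp_rw [h1]
  rw [← Complex.exp_sum, Real.coe_toNNReal _ (real_dotProduct_self_nonneg w)]
  congr 1
  rw [← Finset.sum_div, dotProduct]
  push_cast
  rw [mul_zero, zero_mul, zero_sub, ← neg_div, Finset.sum_mul, ← Finset.sum_neg_distrib]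
  congr 1
  exact Finset.sum_congr rfl fun i _ => by ring

theorem lintegral_sq_gaussianReal (v : NNReal) :
    ∫⁻ x, ENNReal.ofReal (x ^ 2) ∂(gaussianReal 0 v) = v := by
  have h1 := variance_fun_id_gaussianReal (μ := 0) (v := v)
  rw [variance_eq_integral (by fun_prop)] at h1
  simp only [integral_id_gaussianReal, sub_zero] at h1
  have hint : Integrable (fun x : ℝ => x ^ 2) (gaussianReal 0 v) :=
    (memLp_id_gaussianReal' 2 (by simp)).integrable_sq
  rw [← ofReal_integral_eq_lintegral_ofReal hint (ae_of_all _ fun x => sq_nonneg x), h1,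
    ENNReal.ofReal_coe_nnreal]

theorem lintegral_cosh_gaussianReal (v : NNReal) (t : ℝ) :
    ∫⁻ x, ENNReal.ofReal (Real.cosh (t * x)) ∂(gaussianReal 0 v) =
      ENNReal.ofReal (Real.exp (v * t ^ 2 / 2)) := by
  have h : ∀ t : ℝ, ∫ x, Real.exp (t * x) ∂(gaussianReal 0 v) = Real.exp (v * t ^ 2 / 2) := by
    intro t
    have := congrFun (mgf_fun_id_gaussianReal (μ := 0) (v := v)) t
    simpa [mgf] using this
  have hi := fun t => integrable_exp_mul_gaussianReal (μ := 0) (v := v) t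
  have e : (fun x : ℝ => Real.cosh (t * x)) =
      fun x => (Real.exp (t * x) + Real.exp (-t * x)) / 2 := by
    ext x
    rw [Real.cosh_eq, neg_mul]
  have hint : Integrable (fun x : ℝ => Real.cosh (t * x)) (gaussianReal 0 v) := by
    rw [e]
    exact ((hi t).add (hi (-t))).div_const 2
  rw [← ofReal_integral_eq_lintegral_ofReal hint (ae_of_all _ fun x => (Real.cosh_pos _).le), e,
    integral_div, integral_add (hi t) (hi (-t)), h, h]
  congr 1
  rw [neg_sq]
  ring

/-- The exponent turns the density into a Gaussian with rate `3 / (8 * v)`; the exact value is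
`√(4/3)`. -/
theorem lintegral_exp_sq_gaussianReal {v : NNReal} (hv : v ≠ 0) :
    ∫⁻ x, ENNReal.ofReal (Real.exp (x ^ 2 / (8 * v))) ∂(gaussianReal 0 v) ≤ 2 := by
  have hv' : (0 : ℝ) < v := by positivity
  rw [gaussianReal_of_var_ne_zero _ hv, lintegral_withDensity_eq_lintegral_mul _
    (measurable_gaussianPDF _ _) (by fun_prop)]
  set b : ℝ := 3 / (8 * v)
  have hb : 0 < b := by positivity
  have e : ∀ x : ℝ, (gaussianPDF 0 v * fun x => ENNReal.ofReal (Real.exp (x ^ 2 / (8 * v)))) x =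
      ENNReal.ofReal ((√(2 * Real.pi * v))⁻¹ * Real.exp (-b * x ^ 2)) := by
    intro x
    rw [Pi.mul_apply, gaussianPDF, ← ENNReal.ofReal_mul (gaussianPDFReal_nonneg _ _ _),
      gaussianPDFReal, mul_assoc, ← Real.exp_add]
    congr 3
    simp only [b]
    field_simp
    ring
  simp_rw [e]
  rw [← ofReal_integral_eq_lintegral_ofReal ((integrable_exp_neg_mul_sq hb).const_mul _)
    (ae_of_all _ fun x => by positivity), integral_const_mul, integral_gaussian,
    ← Real.sqrt_inv, ← Real.sqrt_mul (by positivity)]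
  have : (2 * Real.pi * (v : ℝ))⁻¹ * (Real.pi / b) = 4 / 3 := by
    simp only [b]
    field_simp
    norm_num
  rw [this]
  refine (ENNReal.ofReal_le_ofReal (q := 2) ?_).trans (by simp)
  rw [Real.sqrt_le_left (by norm_num)]
  norm_num

theorem lintegral_stdGauss_dotProduct {k : ℕ} (w : Fin k → ℝ) {g : ℝ → ENNReal}
    (hg : Measurable g) :
    ∫⁻ x, g (x ⬝ᵥ w) ∂(stdGauss k) = ∫⁻ y, g y ∂(gaussianReal 0 (w ⬝ᵥ w).toNNReal) := by
  rw [← stdGauss_map_dotProduct, lintegral_map hg (by unfold dotProduct; fun_prop)]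

end GaussianForms

/-! ### Moments of Gaussian bilinear forms. -/

section Bilinear

variable {p₁ p₂ : ℕ}

/-- The law of a pair `(β, γ)` of independent standard Gaussian vectors. -/
noncomputable abbrev pairGauss (p₁ p₂ : ℕ) : Measure ((Fin p₁ → ℝ) × (Fin p₂ → ℝ)) :=
  (stdGauss p₁).prod (stdGauss p₂)

/-- The bilinear form `(β, γ) ↦ βᵀ D γ`. -/
def bilin (D : Matrix (Fin p₁) (Fin p₂) ℝ) (z : (Fin p₁ → ℝ) × (Fin p₂ → ℝ)) : ℝ :=
  z.1 ⬝ᵥ (D *ᵥ z.2)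

theorem measurable_bilin (D : Matrix (Fin p₁) (Fin p₂) ℝ) : Measurable (bilin D) := by
  unfold bilin dotProduct mulVec dotProduct
  fun_prop

theorem bilin_eq (D : Matrix (Fin p₁) (Fin p₂) ℝ) (x : Fin p₁ → ℝ) (y : Fin p₂ → ℝ) :
    bilin D (x, y) = y ⬝ᵥ (x ᵥ* D) := by
  rw [bilin, dotProduct_mulVec, dotProduct_comm]

theorem lintegral_bilin (D : Matrix (Fin p₁) (Fin p₂) ℝ) {g : ℝ → ENNReal} (hg : Measurable g) :
    ∫⁻ z, g (bilin D z) ∂(pairGauss p₁ p₂) =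
      ∫⁻ x, ∫⁻ y, g y ∂(gaussianReal 0 ((x ᵥ* D) ⬝ᵥ (x ᵥ* D)).toNNReal) ∂(stdGauss p₁) := by
  rw [lintegral_prod (fun z => g (bilin D z)) (hg.comp (measurable_bilin D)).aemeasurable]
  refine lintegral_congr fun x => ?_
  simp_rw [bilin_eq]
  exact lintegral_stdGauss_dotProduct _ hg

theorem vecMul_dotProduct_self (D : Matrix (Fin p₁) (Fin p₂) ℝ) (x : Fin p₁ → ℝ) :
    (x ᵥ* D) ⬝ᵥ (x ᵥ* D) = ∑ k, (x ⬝ᵥ D.col k) ^ 2 := by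
  simp only [dotProduct, vecMul, sq, col_apply]

theorem sum_col_sq (D : Matrix (Fin p₁) (Fin p₂) ℝ) : ∑ k, D.col k ⬝ᵥ D.col k = ‖D‖ ^ 2 := by
  rw [← frobenius_norm_transpose, frobenius_sq_rows]
  rfl

theorem lintegral_bilin_sq (D : Matrix (Fin p₁) (Fin p₂) ℝ) :
    ∫⁻ z, ENNReal.ofReal (bilin D z ^ 2) ∂(pairGauss p₁ p₂) = ENNReal.ofReal (‖D‖ ^ 2) := by
  rw [lintegral_bilin D (g := fun y => ENNReal.ofReal (y ^ 2)) (by fun_prop)]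
  simp_rw [lintegral_sq_gaussianReal, vecMul_dotProduct_self]
  have : ∀ x : Fin p₁ → ℝ, ((∑ k, (x ⬝ᵥ D.col k) ^ 2).toNNReal : ENNReal) =
      ∑ k, ENNReal.ofReal ((x ⬝ᵥ D.col k) ^ 2) := fun x =>
    ENNReal.ofReal_sum_of_nonneg fun k _ => sq_nonneg _
  simp_rw [this]
  rw [lintegral_finsetSum _ fun k _ => by unfold dotProduct; fun_prop]
  have h2 : ∀ k, ∫⁻ x, ENNReal.ofReal ((x ⬝ᵥ D.col k) ^ 2) ∂(stdGauss p₁) =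
      ENNReal.ofReal (D.col k ⬝ᵥ D.col k) := by
    intro k
    rw [lintegral_stdGauss_dotProduct (g := fun y => ENNReal.ofReal (y ^ 2)) _ (by fun_prop),
      lintegral_sq_gaussianReal]
    rfl
  simp_rw [h2]
  rw [← ENNReal.ofReal_sum_of_nonneg fun k _ => real_dotProduct_self_nonneg _, sum_col_sq]

/-- Given `x`, the form is Gaussian with variance `∑ (x ⬝ᵥ D.col k)²`, so the inner integral is the
exponential of an eighth of it. Jensen with weights `w k = |D.col k|²`, of sum 1, reduces this to
one-dimensional Gaussians, whatever the correlations between columns. -/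
theorem lintegral_cosh_bilin {D : Matrix (Fin p₁) (Fin p₂) ℝ} (hD : ‖D‖ = 1) :
    ∫⁻ z, ENNReal.ofReal (Real.cosh (1 / 2 * bilin D z)) ∂(pairGauss p₁ p₂) ≤ 2 := by
  rw [lintegral_bilin D (g := fun y => ENNReal.ofReal (Real.cosh (1 / 2 * y)))
    (by fun_prop)]
  simp_rw [lintegral_cosh_gaussianReal]
  set w : Fin p₂ → ℝ := fun k => D.col k ⬝ᵥ D.col k
  have hw0 : ∀ k, 0 ≤ w k := fun k => real_dotProduct_self_nonneg _
  have hw1 : ∑ k, w k = 1 := by rw [sum_col_sq, hD, one_pow]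
  have hpt : ∀ x : Fin p₁ → ℝ,
      ENNReal.ofReal (Real.exp ((((x ᵥ* D) ⬝ᵥ (x ᵥ* D)).toNNReal : ℝ) * (1 / 2) ^ 2 / 2)) ≤
        ∑ k, ENNReal.ofReal (w k) * ENNReal.ofReal (Real.exp ((x ⬝ᵥ D.col k) ^ 2 / (8 * w k))) := by
    intro x
    rw [Real.coe_toNNReal _ (real_dotProduct_self_nonneg _), vecMul_dotProduct_self]
    simp_rw [← ENNReal.ofReal_mul (hw0 _)]
    rw [← ENNReal.ofReal_sum_of_nonneg fun k _ => mul_nonneg (hw0 k) (Real.exp_pos _).le]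
    apply ENNReal.ofReal_le_ofReal
    have hj := convexOn_exp.map_sum_le (t := Finset.univ) (w := w)
      (p := fun k => (x ⬝ᵥ D.col k) ^ 2 / (8 * w k)) (fun k _ => hw0 k) hw1 (fun k _ => Set.mem_univ _)
    simp only [smul_eq_mul] at hj
    refine le_trans (le_of_eq ?_) hj
    congr 1
    rw [Finset.sum_mul, Finset.sum_div]
    refine Finset.sum_congr rfl fun k _ => ?_
    -- For a zero column the quotient by `w k` is 0 by convention, matching the true summand.
    by_cases hk : w k = 0
    · have : x ⬝ᵥ D.col k = 0 := by
        have := dotProduct_le_of_sq (x := x) (y := D.col k)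
        rw [show D.col k ⬝ᵥ D.col k = 0 from hk, mul_zero] at this
        exact pow_eq_zero_iff two_ne_zero |>.mp (le_antisymm this (sq_nonneg _))
      rw [this, hk]
      simp
    · field_simp
      norm_num
  refine (lintegral_mono hpt).trans ?_
  rw [lintegral_finsetSum _ fun k _ => by unfold dotProduct; fun_prop]
  calc _ ≤ ∑ k, ENNReal.ofReal (w k) * 2 := by
        refine Finset.sum_le_sum fun k _ => ?_
        rw [lintegral_const_mul _ (by unfold dotProduct; fun_prop)]
        by_cases hk : w k = 0
        · simp [hk]
        gcongr
        rw [lintegral_stdGauss_dotProduct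
          (g := fun y => ENNReal.ofReal (Real.exp (y ^ 2 / (8 * w k)))) _ (by fun_prop)]
        have hk' : (w k).toNNReal ≠ 0 := by
          simpa [Real.toNNReal_eq_zero] using lt_of_le_of_ne (hw0 k) (Ne.symm hk)
        have := lintegral_exp_sq_gaussianReal hk'
        rwa [Real.coe_toNNReal _ (hw0 k)] at this
    _ = 2 := by
        rw [← Finset.sum_mul, ← ENNReal.ofReal_sum_of_nonneg fun k _ => hw0 k, hw1]
        simp

theorem integrable_cosh_bilin {D : Matrix (Fin p₁) (Fin p₂) ℝ} (hD : ‖D‖ = 1) :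
    Integrable (fun z => Real.cosh (1 / 2 * bilin D z)) (pairGauss p₁ p₂) ∧
      ∫ z, Real.cosh (1 / 2 * bilin D z) ∂(pairGauss p₁ p₂) ≤ 2 := by
  have hm : Measurable (fun z => Real.cosh (1 / 2 * bilin D z)) := by
    have := measurable_bilin D
    fun_prop
  have h0 : 0 ≤ᵐ[pairGauss p₁ p₂] fun z => Real.cosh (1 / 2 * bilin D z) :=
    ae_of_all _ fun z => (Real.cosh_pos _).le
  have hle := lintegral_cosh_bilin hD
  constructor
  · refine ⟨hm.aestronglyMeasurable, ?_⟩
    rw [hasFiniteIntegral_iff_ofReal h0]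
    exact hle.trans_lt (by simp)
  · rw [integral_eq_lintegral_of_nonneg_ae h0 hm.aestronglyMeasurable]
    exact ENNReal.toReal_le_of_le_ofReal (by norm_num) (by simpa using hle)

theorem pow_four_le_cosh (y : ℝ) : y ^ 4 ≤ 768 * Real.cosh (1 / 2 * y) := by
  have h := Real.pow_div_factorial_le_exp (|1 / 2 * y|) (abs_nonneg _) 4
  rw [← Real.cosh_abs, Real.cosh_eq]
  have h2 := Real.exp_pos (-|1 / 2 * y|)
  have h3 : |1 / 2 * y| ^ 4 = y ^ 4 / 16 := by
    rw [← abs_pow, abs_of_nonneg (by positivity)]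
    ring
  rw [h3] at h
  norm_num [Nat.factorial] at h h2 ⊢
  linarith

theorem integral_exp_abs_bilin {D : Matrix (Fin p₁) (Fin p₂) ℝ} (hD : ‖D‖ = 1) :
    Integrable (fun z => Real.exp (1 / 2 * |bilin D z|)) (pairGauss p₁ p₂) ∧
      ∫ z, Real.exp (1 / 2 * |bilin D z|) ∂(pairGauss p₁ p₂) ≤ 4 := by
  obtain ⟨hi, hle⟩ := integrable_cosh_bilin hD
  have hpt : ∀ z, Real.exp (1 / 2 * |bilin D z|) ≤ 2 * Real.cosh (1 / 2 * bilin D z) := by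
    intro z
    have e : 1 / 2 * |bilin D z| = |1 / 2 * bilin D z| := by rw [abs_mul]; norm_num
    rw [e, ← Real.cosh_abs, Real.cosh_eq]
    have := Real.exp_pos (-|1 / 2 * bilin D z|)
    linarith
  have hi' : Integrable (fun z => Real.exp (1 / 2 * |bilin D z|)) (pairGauss p₁ p₂) := by
    refine (hi.const_mul 2).mono' ?_ (ae_of_all _ fun z => ?_)
    · have := measurable_bilin D
      exact Measurable.aestronglyMeasurable (by fun_prop)
    · rw [Real.norm_eq_abs, abs_of_pos (Real.exp_pos _)]
      exact hpt z
  refine ⟨hi', (integral_mono hi' (hi.const_mul 2) hpt).trans ?_⟩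
  rw [integral_const_mul]
  linarith

theorem exp_neg_le_quadratic {x : ℝ} (hx : 0 ≤ x) : Real.exp (-x) ≤ 1 - x + x ^ 2 / 2 := by
  have h1 := Real.quadratic_le_exp_of_nonneg hx
  rw [Real.exp_neg, inv_le_iff_one_le_mul₀ (Real.exp_pos _)]
  have h2 : 0 < 1 - x + x ^ 2 / 2 := by nlinarith [sq_nonneg (x - 1)]
  have h3 : (1 - x + x ^ 2 / 2) * (1 + x + x ^ 2 / 2) = 1 + x ^ 4 / 4 := by ring
  have h4 : 0 ≤ x ^ 4 := by positivity
  nlinarith [mul_le_mul_of_nonneg_left h1 h2.le]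

/-- From `|y| ≥ y²/L - y⁴/L³` with `L = 56`. As `L² > 2 * 1536` and the fourth moment is at most
1536, at least half of the second moment survives and `E|Y| ≥ 1/112`. The rate `1/112` minimizes `1
- s/112 + s²/2`, with minimum `1 - 1/25088`. -/
theorem exp_neg_abs_le_quartic (y : ℝ) :
    Real.exp (-(1 / 112 * |y|)) ≤ 1 - 3 / 25088 * y ^ 2 + 1 / 19668992 * y ^ 4 := by
  have h := exp_neg_le_quadratic (x := 1 / 112 * |y|) (by positivity)
  have h1 : |y| ^ 2 = y ^ 2 := sq_abs y
  have h2 : y ^ 2 / 56 - y ^ 4 / 175616 ≤ |y| := by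
    have e : y ^ 4 = |y| ^ 4 := by rw [← abs_pow, abs_of_nonneg (by positivity : 0 ≤ y ^ 4)]
    rw [← h1, e]
    set a := |y|
    have ha : 0 ≤ a := abs_nonneg y
    by_cases h56 : a ≤ 56
    · have : a ^ 2 ≤ 56 * a := by nlinarith
      have : 0 ≤ a ^ 4 := by positivity
      linarith
    · push Not at h56
      have h3 : 3136 ≤ a ^ 2 := by nlinarith
      have := mul_le_mul_of_nonneg_right h3 (sq_nonneg a)
      have e4 : a ^ 2 * a ^ 2 = a ^ 4 := by ring
      rw [e4] at this
      linarith
  have h3 : (1 / 112 * |y|) ^ 2 / 2 = y ^ 2 / 25088 := by rw [mul_pow, h1]; ring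
  rw [h3] at h
  linarith

theorem integral_exp_neg_abs_bilin {D : Matrix (Fin p₁) (Fin p₂) ℝ} (hD : ‖D‖ = 1) :
    Integrable (fun z => Real.exp (-(1 / 112 * |bilin D z|))) (pairGauss p₁ p₂) ∧
      ∫ z, Real.exp (-(1 / 112 * |bilin D z|)) ∂(pairGauss p₁ p₂) ≤ Real.exp (-(1 / 25088)) := by
  obtain ⟨hi, hle⟩ := integrable_cosh_bilin hD
  have hmeas := measurable_bilin D
  have h2 : Integrable (fun z => bilin D z ^ 2) (pairGauss p₁ p₂) ∧
      ∫ z, bilin D z ^ 2 ∂(pairGauss p₁ p₂) = 1 := by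
    have h0 : 0 ≤ᵐ[pairGauss p₁ p₂] fun z => bilin D z ^ 2 := ae_of_all _ fun z => sq_nonneg _
    have he := lintegral_bilin_sq D
    rw [hD, one_pow] at he
    constructor
    · refine ⟨Measurable.aestronglyMeasurable (by fun_prop), ?_⟩
      rw [hasFiniteIntegral_iff_ofReal h0, he]
      simp
    · rw [integral_eq_lintegral_of_nonneg_ae h0 (Measurable.aestronglyMeasurable (by fun_prop)), he]
      simp
  have h4 : Integrable (fun z => bilin D z ^ 4) (pairGauss p₁ p₂) := by
    refine (hi.const_mul 768).mono' (Measurable.aestronglyMeasurable (by fun_prop))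
      (ae_of_all _ fun z => ?_)
    rw [Real.norm_eq_abs, abs_of_nonneg (by positivity)]
    exact pow_four_le_cosh _
  have h4' : ∫ z, bilin D z ^ 4 ∂(pairGauss p₁ p₂) ≤ 1536 := by
    refine (integral_mono h4 (hi.const_mul 768) fun z => pow_four_le_cosh _).trans ?_
    rw [integral_const_mul]
    linarith
  have hexp : Integrable (fun z => Real.exp (-(1 / 112 * |bilin D z|))) (pairGauss p₁ p₂) := by
    refine (integrable_const (1 : ℝ)).mono' (Measurable.aestronglyMeasurable (by fun_prop))
      (ae_of_all _ fun z => ?_)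
    rw [Real.norm_eq_abs, abs_of_pos (Real.exp_pos _), Real.exp_le_one_iff]
    have := abs_nonneg (bilin D z)
    linarith
  refine ⟨hexp, ?_⟩
  have hA : Integrable (fun z => 1 - 3 / 25088 * bilin D z ^ 2) (pairGauss p₁ p₂) :=
    (integrable_const 1).sub (h2.1.const_mul _)
  have hB : Integrable (fun z => 1 / 19668992 * bilin D z ^ 4) (pairGauss p₁ p₂) :=
    h4.const_mul _
  refine (integral_mono hexp (hA.add hB) fun z => exp_neg_abs_le_quartic _).trans ?_
  rw [integral_add' hA hB, integral_sub (integrable_const 1) (h2.1.const_mul _),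
    integral_const_mul, integral_const_mul, h2.2]
  simp only [integral_const, probReal_univ, smul_eq_mul, mul_one]
  have := Real.add_one_le_exp (-(1 / 25088 : ℝ))
  linarith

end Bilinear

/-! ### Concentration and the union bound. -/

section Concentration

/-- Chernoff's bound for sums of independent identically distributed variables. -/
theorem chernoff_pi {X : Type*} [MeasurableSpace X] (μ : Measure X) [IsProbabilityMeasure μ]
    {h : X → ℝ} (hi : Integrable (fun x => Real.exp (h x)) μ) {a : ℝ}
    (ha : ∫ x, Real.exp (h x) ∂μ ≤ Real.exp (-a)) (n : ℕ) :
    (Measure.pi fun _ : Fin n => μ).real {z | 0 ≤ ∑ i, h (z i)} ≤ Real.exp (-(n * a)) := by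
  have hprod : Integrable (fun z : Fin n → X => ∏ i, Real.exp (h (z i)))
      (Measure.pi fun _ : Fin n => μ) :=
    Integrable.fintype_prod (f := fun _ x => Real.exp (h x)) fun _ => hi
  have hmarkov := mul_meas_ge_le_integral_of_nonneg
    (ae_of_all _ fun z => Finset.prod_nonneg fun i _ => (Real.exp_pos _).le) hprod 1
  rw [one_mul, integral_fintype_prod_eq_pow (fun x => Real.exp (h x)), Fintype.card_fin] at hmarkov
  have hset : {z : Fin n → X | 0 ≤ ∑ i, h (z i)} = {z | 1 ≤ ∏ i, Real.exp (h (z i))} := by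
    ext z
    rw [Set.mem_ofPred_eq, Set.mem_ofPred_eq, ← Real.exp_sum, Real.one_le_exp_iff]
  rw [hset]
  refine hmarkov.trans ((pow_le_pow_left₀ (integral_nonneg fun x => (Real.exp_pos _).le) ha n).trans
    (le_of_eq ?_))
  rw [← Real.exp_nat_mul]
  congr 1
  ring

variable {p₁ p₂ : ℕ}

/-- The joint law of `n` independent pairs of standard Gaussian vectors. -/
noncomputable abbrev sampleGauss (n p₁ p₂ : ℕ) :
    Measure (Fin n → (Fin p₁ → ℝ) × (Fin p₂ → ℝ)) :=
  Measure.pi fun _ => pairGauss p₁ p₂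

/-- The `ℓ¹`-norm of the measurements of `D`. -/
def measurementNorm {n : ℕ} (z : Fin n → (Fin p₁ → ℝ) × (Fin p₂ → ℝ)) :
    Seminorm ℝ (Matrix (Fin p₁) (Fin p₂) ℝ) :=
  Seminorm.of (fun D => ∑ i, |bilin D (z i)|)
    (fun D D' => by
      rw [← Finset.sum_add_distrib]
      refine Finset.sum_le_sum fun i _ => ?_
      rw [bilin, Matrix.add_mulVec, dotProduct_add]
      exact abs_add_le _ _)
    (fun c D => by
      rw [Finset.mul_sum]
      refine Finset.sum_congr rfl fun i _ => ?_
      rw [bilin, Matrix.smul_mulVec, dotProduct_smul, smul_eq_mul, abs_mul, Real.norm_eq_abs]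
      rfl)

theorem measurementNorm_apply {n : ℕ} (z : Fin n → (Fin p₁ → ℝ) × (Fin p₂ → ℝ))
    (D : Matrix (Fin p₁) (Fin p₂) ℝ) : measurementNorm z D = ∑ i, |bilin D (z i)| := rfl

/-- The samples for which the measurements distort the size of `D`. -/
def distorted (n : ℕ) (D : Matrix (Fin p₁) (Fin p₂) ℝ) :
    Set (Fin n → (Fin p₁ → ℝ) × (Fin p₂ → ℝ)) :=
  {z | measurementNorm z D < n / 448 * ‖D‖ ∨ 6 * n * ‖D‖ < measurementNorm z D}

theorem measurableSet_distorted (n : ℕ) (D : Matrix (Fin p₁) (Fin p₂) ℝ) :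
    MeasurableSet (distorted n D) := by
  have hb := measurable_bilin D
  have : Measurable fun z : Fin n → (Fin p₁ → ℝ) × (Fin p₂ → ℝ) => measurementNorm z D := by
    simp only [measurementNorm_apply]
    fun_prop
  exact (measurableSet_lt this measurable_const).union (measurableSet_lt measurable_const this)

/-- The threshold `1/448` gives back half of the exponent `1/25088`. Above, `E exp(|Y|/2) ≤ 4 ≤ e²`
against the threshold 6 leaves `e⁻¹` per sample. -/
theorem measure_distorted_le_of_norm_eq_one (n : ℕ) {D : Matrix (Fin p₁) (Fin p₂) ℝ}
    (hD : ‖D‖ = 1) :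
    (sampleGauss n p₁ p₂).real (distorted n D) ≤ 2 * Real.exp (-(n * (1 / 50176))) := by
  have hlow : (sampleGauss n p₁ p₂).real
      {z | 0 ≤ ∑ i, (1 / 112 * (1 / 448) + -(1 / 112 * |bilin D (z i)|))} ≤
        Real.exp (-(n * (1 / 50176))) := by
    obtain ⟨hi, hle⟩ := integral_exp_neg_abs_bilin hD
    refine chernoff_pi (pairGauss p₁ p₂)
      (h := fun z => 1 / 112 * (1 / 448) + -(1 / 112 * |bilin D z|)) ?_ ?_ n
    · simp_rw [Real.exp_add]
      exact hi.const_mul _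
    · simp_rw [Real.exp_add]
      rw [integral_const_mul]
      refine (mul_le_mul_of_nonneg_left hle (Real.exp_pos _).le).trans ?_
      rw [← Real.exp_add]
      exact Real.exp_le_exp.mpr (by norm_num)
  have hup : (sampleGauss n p₁ p₂).real
      {z | 0 ≤ ∑ i, (-3 + 1 / 2 * |bilin D (z i)|)} ≤ Real.exp (-(n * (1 / 50176))) := by
    obtain ⟨hi, hle⟩ := integral_exp_abs_bilin hD
    refine chernoff_pi (pairGauss p₁ p₂) (h := fun z => -3 + 1 / 2 * |bilin D z|) ?_ ?_ n
    · simp_rw [Real.exp_add]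
      exact hi.const_mul _
    · simp_rw [Real.exp_add]
      rw [integral_const_mul]
      have h4 : (4 : ℝ) ≤ Real.exp 2 := by
        have := Real.quadratic_le_exp_of_nonneg (x := 2) (by norm_num)
        linarith
      refine (mul_le_mul_of_nonneg_left (hle.trans h4) (Real.exp_pos _).le).trans ?_
      rw [← Real.exp_add]
      exact Real.exp_le_exp.mpr (by norm_num)
  have hsub : distorted n D ⊆
      {z | 0 ≤ ∑ i, (1 / 112 * (1 / 448) + -(1 / 112 * |bilin D (z i)|))} ∪
        {z | 0 ≤ ∑ i, (-3 + 1 / 2 * |bilin D (z i)|)} := by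
    intro z hz
    simp only [Set.mem_union, Set.mem_ofPred_eq, Finset.sum_add_distrib, Finset.sum_neg_distrib,
      ← Finset.mul_sum, Finset.sum_const, Finset.card_univ, Fintype.card_fin, nsmul_eq_mul]
    simp only [distorted, Set.mem_ofPred_eq, hD, measurementNorm_apply] at hz
    rcases hz with hz | hz
    · left; linarith
    · right; linarith
  have h1 := measureReal_mono (μ := sampleGauss n p₁ p₂) hsub
  have h2 := measureReal_union_le (μ := sampleGauss n p₁ p₂)
    {z | 0 ≤ ∑ i, (1 / 112 * (1 / 448) + -(1 / 112 * |bilin D (z i)|))}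
    {z | 0 ≤ ∑ i, (-3 + 1 / 2 * |bilin D (z i)|)}
  linarith

theorem measure_distorted_le (n : ℕ) (D : Matrix (Fin p₁) (Fin p₂) ℝ) :
    (sampleGauss n p₁ p₂).real (distorted n D) ≤ 2 * Real.exp (-(n * (1 / 50176))) := by
  by_cases hD : D = 0
  · have : distorted n D = ∅ := by
      ext z
      simp [distorted, hD]
    rw [this, measureReal_empty]
    positivity
  have hD' : 0 < ‖D‖ := norm_pos_iff.mpr hD
  have hu : ‖‖D‖⁻¹ • D‖ = 1 := by rw [norm_smul, norm_inv, norm_norm, inv_mul_cancel₀ hD'.ne']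
  have : distorted n D = distorted n (‖D‖⁻¹ • D) := by
    ext z
    simp only [distorted, Set.mem_ofPred_eq, hu, map_smul_eq_mul, norm_inv, norm_norm, mul_one]
    rw [inv_mul_lt_iff₀ hD', lt_inv_mul_iff₀ hD', mul_comm ‖D‖, mul_comm ‖D‖]
  rw [this]
  exact measure_distorted_le_of_norm_eq_one n hu

theorem recoversRank_of_not_distorted {n r m : ℕ} (hn : 0 < n) (hr : 0 < r)
    (hm : m = 30000 ^ 2 * r)
    {NA : Finset (Matrix (Fin p₁) (Fin m) ℝ)} {NB : Finset (Matrix (Fin p₂) (Fin m) ℝ)}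
    (hNA : ∀ x : Matrix (Fin p₁) (Fin m) ℝ, ‖x‖ ≤ 1 → ∃ y ∈ NA, ‖x - y‖ ≤ 1 / 50000)
    (hNA1 : ∀ y ∈ NA, ‖y‖ ≤ 1) (hNB1 : ∀ y ∈ NB, y.IsContraction)
    (hNB : ∀ x : Matrix (Fin p₂) (Fin m) ℝ, x.IsContraction →
      ∃ y ∈ NB, ((1 / 50000 : ℝ)⁻¹ • (x - y)).IsContraction)
    (z : Fin n → (Fin p₁ → ℝ) × (Fin p₂ → ℝ))
    (hz : ∀ A ∈ NA, ∀ B ∈ NB, z ∉ distorted n (A * Bᵀ)) :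
    RecoversRank (ropMap (fun i => (z i).1) (fun i => (z i).2)) r := by
  have hn' : (0 : ℝ) < n := by exact_mod_cast hn
  simp only [distorted, Set.mem_ofPred_eq, not_or, not_lt] at hz
  have hup := (measurementNorm z).factor_upper (t := 6 * n) (by norm_num) (by norm_num) hNA hNA1 hNB
    (fun A hA B hB => (hz A hA B hB).2.trans (mul_le_of_le_one_right (by positivity)
      (((hNB1 B hB).norm_mul_transpose_le A).trans (hNA1 A hA))))
  have hlow := (measurementNorm z).factor_lower (c := n / 448) (by norm_num) (by positivity)
    hNA hNA1 hNB (fun A hA B hB => (hz A hA B hB).1) hup (by positivity)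
  refine recoversRank_of_cone _ fun H hH hker => ?_
  refine (measurementNorm z).eq_zero_of_factor_bounds (θ := 1 / 10000) (by positivity)
    (by positivity) (by positivity) (by rw [hm]; positivity) hup hlow ?_ ?_ ?_
  -- Here `c = n/448`, `t = 12n` and `η = 2(c + t)/50000`: the left side is about `0.00168 n`, and
  -- `c` about `0.00223 n`.
  · nlinarith
  -- The width is chosen so that `√m / 10000 = 3√r`.
  · refine hH.trans (le_of_eq ?_)
    rw [hm]
    push_cast
    norm_num only
    rw [Real.sqrt_mul (by positivity), show (900000000 : ℝ) = 30000 ^ 2 by norm_num,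
      Real.sqrt_sq (by norm_num)]
    ring
  · rw [measurementNorm_apply]
    refine Finset.sum_eq_zero fun i _ => ?_
    rw [abs_eq_zero]
    exact congrFun hker i

theorem exists_exceptional_set {n p₁ p₂ r : ℕ} (hpos : 0 < r * (p₁ + p₂))
    (hn : 100352 * (12 * 30000 ^ 2 + 1) * ((r : ℝ) * (p₁ + p₂)) ≤ n) :
    ∃ S : Set (Fin n → (Fin p₁ → ℝ) × (Fin p₂ → ℝ)), MeasurableSet S ∧
      (sampleGauss n p₁ p₂).real S ≤ Real.exp (-(n * (1 / 100352))) ∧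
      ∀ z ∉ S, RecoversRank (ropMap (fun i => (z i).1) (fun i => (z i).2)) r := by
  set N : ℝ := (r : ℝ) * (p₁ + p₂) with hN
  have hN1 : 1 ≤ N := by
    rw [hN]
    exact_mod_cast hpos
  have hr : 0 < r := Nat.pos_of_mul_pos_right hpos
  have hn0 : 0 < n := by
    have : (0 : ℝ) < n := by linarith
    exact_mod_cast this
  obtain ⟨NA, hcA, hNA1, hNA⟩ := exists_net_frobenius p₁ (30000 ^ 2 * r)
    (ε := 1 / 50000) (by norm_num) (by norm_num)
  obtain ⟨NB, hcB, hNB1, hNB⟩ := exists_net_contraction p₂ (30000 ^ 2 * r)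
    (ε := 1 / 50000) (by norm_num) (by norm_num)
  refine ⟨⋃ q ∈ NA ×ˢ NB, distorted n (q.1 * q.2ᵀ),
    Finset.measurableSet_biUnion _ fun q _ => measurableSet_distorted n _, ?_, fun z hz => ?_⟩
  · refine (measureReal_biUnion_finset_le _ _).trans ?_
    refine (Finset.sum_le_sum fun q _ => measure_distorted_le n _).trans ?_
    rw [Finset.sum_const, nsmul_eq_mul, Finset.card_product, Nat.cast_mul]
    -- Each net coordinate costs a factor 150000, below `e¹²`.
    have hbase : (3 / (1 / 50000) : ℝ) ≤ Real.exp 12 := by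
      have h1 := Real.exp_one_gt_d9
      have h2 : Real.exp 12 = Real.exp 1 ^ 12 := by rw [← Real.exp_nat_mul]; norm_num
      rw [h2]
      refine le_trans ?_ (pow_le_pow_left₀ (by norm_num) h1.le 12)
      norm_num
    have hpow : ∀ k : ℕ, (3 / (1 / 50000) : ℝ) ^ k ≤ Real.exp (12 * k) := by
      intro k
      refine (pow_le_pow_left₀ (by norm_num) hbase k).trans (le_of_eq ?_)
      rw [← Real.exp_nat_mul, mul_comm]
    have hcard : (NA.card : ℝ) * NB.card ≤ Real.exp (12 * 30000 ^ 2 * N) := by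
      refine (mul_le_mul (hcA.trans (hpow _)) (hcB.trans (hpow _)) (by positivity)
        (Real.exp_pos _).le).trans (le_of_eq ?_)
      rw [← Real.exp_add, hN]
      congr 1
      push_cast
      ring
    have h2 : (2 : ℝ) ≤ Real.exp 1 := by
      have := Real.add_one_le_exp (1 : ℝ)
      linarith
    refine (mul_le_mul hcard (mul_le_mul_of_nonneg_right h2 (Real.exp_pos _).le) (by positivity)
      (Real.exp_pos _).le).trans ?_
    rw [← Real.exp_add, ← Real.exp_add]
    -- Half of the exponent `n/50176` absorbs the net cardinalities and, as `N ≥ 1`, the factor `2 ≤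
    -- e`.
    exact Real.exp_le_exp.mpr (by linarith)
  · refine recoversRank_of_not_distorted hn0 hr rfl hNA hNA1 hNB1 hNB z fun A hA B hB hd => hz ?_
    exact Set.mem_biUnion (x := (A, B)) (Finset.mem_product.mpr ⟨hA, hB⟩) hd

end Concentration

/-! ### The joint law of the samples. -/

section Law

/-- Regrouping the coordinates of the samples into one family. -/
def flattenSample {n p₁ p₂ : ℕ} (z : Fin n → (Fin p₁ → ℝ) × (Fin p₂ → ℝ)) :
    (Fin n × Fin p₁) ⊕ (Fin n × Fin p₂) → ℝ :=
  Sum.elim (fun q => (z q.1).1 q.2) (fun q => (z q.1).2 q.2)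

theorem measurable_flattenSample {n p₁ p₂ : ℕ} :
    Measurable (flattenSample (n := n) (p₁ := p₁) (p₂ := p₂)) := by
  refine measurable_pi_iff.mpr fun q => ?_
  rcases q with q | q
  · change Measurable fun z : Fin n → (Fin p₁ → ℝ) × (Fin p₂ → ℝ) => (z q.1).1 q.2
    fun_prop
  · change Measurable fun z : Fin n → (Fin p₁ → ℝ) × (Fin p₂ → ℝ) => (z q.1).2 q.2
    fun_prop

theorem map_flattenSample (n p₁ p₂ : ℕ) :
    (sampleGauss n p₁ p₂).map flattenSample = Measure.pi fun _ => gaussianReal 0 1 := by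
  refine (Measure.pi_eq fun s hs => ?_).symm
  rw [Measure.map_apply measurable_flattenSample (MeasurableSet.univ_pi hs)]
  have : flattenSample ⁻¹' Set.univ.pi s = Set.univ.pi fun i : Fin n =>
      (Set.univ.pi fun j : Fin p₁ => s (Sum.inl (i, j))) ×ˢ
        (Set.univ.pi fun k : Fin p₂ => s (Sum.inr (i, k))) := by
    ext z
    simp [flattenSample, Set.mem_pi, Prod.forall, forall_and]
  rw [this, Measure.pi_pi, Fintype.prod_sum_type, Fintype.prod_prod_type, Fintype.prod_prod_type,
    ← Finset.prod_mul_distrib]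
  refine Finset.prod_congr rfl fun i _ => ?_
  rw [Measure.prod_prod, Measure.pi_pi, Measure.pi_pi]

theorem hasLaw_sample {Ω : Type*} [MeasurableSpace Ω] {P : Measure Ω} {n p₁ p₂ : ℕ}
    {β : Fin n → Fin p₁ → Ω → ℝ} {γ : Fin n → Fin p₂ → Ω → ℝ}
    (hβ : ∀ i j, HasLaw (β i j) (gaussianReal 0 1) P)
    (hγ : ∀ i k, HasLaw (γ i k) (gaussianReal 0 1) P)
    (hind : iIndepFun
      (Sum.elim (fun q : Fin n × Fin p₁ => β q.1 q.2) (fun q : Fin n × Fin p₂ => γ q.1 q.2)) P) :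
    HasLaw (fun ω i => ((fun j => β i j ω, fun k => γ i k ω) : (Fin p₁ → ℝ) × (Fin p₂ → ℝ)))
      (sampleGauss n p₁ p₂) P := by
  have hjoint : HasLaw (fun ω q => Sum.elim (fun q : Fin n × Fin p₁ => β q.1 q.2)
      (fun q : Fin n × Fin p₂ => γ q.1 q.2) q ω) (Measure.pi fun _ => gaussianReal 0 1) P := by
    refine hind.hasLaw_pi fun q => ?_
    rcases q with q | q
    · exact hβ q.1 q.2
    · exact hγ q.1 q.2
  let Φ : ((Fin n × Fin p₁) ⊕ (Fin n × Fin p₂) → ℝ) → Fin n → (Fin p₁ → ℝ) × (Fin p₂ → ℝ) :=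
    fun x i => (fun j => x (Sum.inl (i, j)), fun k => x (Sum.inr (i, k)))
  have hΦ : Measurable Φ := by fun_prop
  -- `Φ` undoes `flattenSample`, so the law passes back through `map_flattenSample`.
  have hΦlaw : HasLaw Φ (sampleGauss n p₁ p₂) (Measure.pi fun _ => gaussianReal 0 1) := by
    refine ⟨hΦ.aemeasurable, ?_⟩
    rw [← map_flattenSample, Measure.map_map hΦ measurable_flattenSample]
    exact Measure.map_id
  exact hΦlaw.comp hjoint

end Law

/-! ### Degenerate sizes and conclusion. -/

theorem recoversRank_zero {n p₁ p₂ : ℕ}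
    (𝒳 : Matrix (Fin p₁) (Fin p₂) ℝ →ₗ[ℝ] (Fin n → ℝ)) : RecoversRank 𝒳 0 := by
  refine recoversRank_of_cone 𝒳 fun H hH _ => ?_
  simp only [Nat.cast_zero, Real.sqrt_zero, mul_zero, zero_mul] at hH
  have h0 : nuclearNorm H = 0 :=
    le_antisymm hH (Finset.sum_nonneg fun i _ => sv_nonneg H i)
  have hs := (Finset.sum_eq_zero_iff_of_nonneg fun i _ => sv_nonneg H i).mp h0
  have hT : (Matrix.toEuclideanLin H).singularValues = 0 := by
    ext i
    rcases lt_or_ge i p₂ with hi | hi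
    · exact hs i (Finset.mem_range.mpr hi)
    · exact sv_eq_zero H hi
  exact Matrix.toEuclideanLin.map_eq_zero_iff.mp ((LinearMap.singularValues_eq_zero_iff _).mp hT)

theorem corollary2p1 :
    ∃ C δ : ℝ, 0 < C ∧ 0 < δ ∧
      ∀ (n p₁ p₂ r : ℕ), C * (r * (p₁ + p₂)) ≤ (n : ℝ) →
      ∀ (Ω : Type*) [MeasurableSpace Ω] (P : Measure Ω) [IsProbabilityMeasure P]
        (𝒳 : Ω → Matrix (Fin p₁) (Fin p₂) ℝ →ₗ[ℝ] (Fin n → ℝ)),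
        IsROP 𝒳 (gaussianReal 0 1) P →
        ∃ E : Set Ω, MeasurableSet E ∧ 1 - Real.exp (-(n * δ)) ≤ P.real E ∧
          ∀ ω ∈ E, RecoversRank (𝒳 ω) r := by
  refine ⟨100352 * (12 * 30000 ^ 2 + 1), 1 / 100352, by norm_num, by norm_num, ?_⟩
  intro n p₁ p₂ r hn Ω _ P _ 𝒳 hX
  -- If `r * (p₁ + p₂) = 0` then `n` may be 0, but recovery is deterministic: the cone is trivial or
  -- the matrix space is.
  rcases Nat.eq_zero_or_pos (r * (p₁ + p₂)) with h0 | hpos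
  · refine ⟨Set.univ, MeasurableSet.univ, ?_, fun ω _ => ?_⟩
    · rw [probReal_univ]
      have := Real.exp_pos (-(n * (1 / 100352) : ℝ))
      linarith
    · rcases Nat.mul_eq_zero.mp h0 with rfl | hp
      · exact recoversRank_zero _
      · obtain rfl : p₁ = 0 := by omega
        exact recoversRank_of_cone _ fun H _ _ => Subsingleton.elim _ _
  · obtain ⟨β, γ, hβ, hγ, hind, hform⟩ := hX
    obtain ⟨S, hS, hSle, hrec⟩ := exists_exceptional_set hpos hn
    set bad : Set Ω :=
      (fun ω i => ((fun j => β i j ω, fun k => γ i k ω) : (Fin p₁ → ℝ) × (Fin p₂ → ℝ))) ⁻¹' S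
    have hbad : P.real bad = (sampleGauss n p₁ p₂).real S :=
      (hasLaw_sample hβ hγ hind).measureReal_eq hS
    -- The samples are only almost everywhere measurable, so `bad` is replaced by a measurable hull
    -- of equal measure.
    refine ⟨(toMeasurable P bad)ᶜ, (measurableSet_toMeasurable _ _).compl, ?_, fun ω hω => ?_⟩
    · rw [probReal_compl_eq_one_sub (measurableSet_toMeasurable _ _), measureReal_def,
        measure_toMeasurable, ← measureReal_def, hbad]
      linarith
    · rw [hform]
      exact hrec _ fun h => hω (subset_toMeasurable P bad h)
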